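/- Let $k \geq 2$ be an integer. A $k$-star is a copy of the complete bipartite graph $K_{1,k}$, and a $k$-star decomposition of a graph $G$ is a set of $k$-stars whose edge sets partition $E(G)$. For a set $V$, let $K_V$ be the complete graph with vertex set $V$. A partial $k$-star design of order $n$ is a pair $(V,\mathcal{A})$ where $V$ is a set of $n$ vertices and $\mathcal{A}$ is a $k$-star decomposition of some subgraph $G$ of $K_V$; it is a $k$-star design if $G=K_V$. A completion of a partial $k$-star design $(V,\mathcal{A})$ is a $k$-star design $(V,\mathcal{B})$ with $\mathcal{A} \subseteq \mathcal{B}$. A positive integer $n$ is $k$-admissible if $\binom{n}{2} \equiv 0 \pmod{k}$. For integers $n>1$ define \[u(n,k)=\begin{cases} 2\left\lfloor \frac{n-2}{k} \right\rfloor - 1 & \text{if } n \not\equiv 1 \pmod{k},\\ \frac{2(n-1)}{k}-2 & \text{if } n \equiv 1 \pmod{k}.\end{cases}\] For each $k$-admissible integer $n \geq 2k$, every partial $k$-star design of order $n$ with at most $u(n,k)$ stars has a completion. Furthermore, for each $k$-admissible integer $n>1$, there is a partial $k$-star design of order $n$ with exactly $u(n,k)+1$ stars that has no completion. -/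

import Mathlib

/-- A positive integer `n` is `k`-admissible if `n.choose 2 ≡ 0` modulo `k`. -/
def Admissible (k n : ℕ) : Prop :=
  0 < n ∧ n.choose 2 ≡ 0 [MOD k]

/-- A `k`-star in the complete graph on `V`: a subgraph that is a copy of `K_{1,k}`. -/
def IsStar {V : Type*} (k : ℕ) (S : (⊤ : SimpleGraph V).Subgraph) : Prop :=
  Nonempty (S.coe ≃g completeBipartiteGraph (Fin 1) (Fin k))

/-- `A` is a `k`-star decomposition of the subgraph `G` of the complete graph on `V`:
a set of `k`-stars whose edge sets partition the edge set of `G`. -/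
structure IsStarDecomposition {V : Type*} (k : ℕ) (A : Finset (⊤ : SimpleGraph V).Subgraph)
    (G : (⊤ : SimpleGraph V).Subgraph) : Prop where
  isStar : ∀ S ∈ A, IsStar k S
  disjoint : ∀ S ∈ A, ∀ T ∈ A, S ≠ T → Disjoint S.edgeSet T.edgeSet
  union : ⋃ S ∈ A, S.edgeSet = G.edgeSet

/-- `(V, A)` is a partial `k`-star design: `A` is a `k`-star decomposition of some subgraph of
the complete graph on `V`. -/
def IsPartialStarDesign {V : Type*} (k : ℕ) (A : Finset (⊤ : SimpleGraph V).Subgraph) : Prop :=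
  ∃ G : (⊤ : SimpleGraph V).Subgraph, IsStarDecomposition k A G

/-- `(V, B)` is a `k`-star design: `B` is a `k`-star decomposition of the complete graph
on `V`. -/
def IsStarDesign {V : Type*} (k : ℕ) (B : Finset (⊤ : SimpleGraph V).Subgraph) : Prop :=
  IsStarDecomposition k B ⊤

/-- `(V, A)` has a completion: there is a `k`-star design `(V, B)` with `A ⊆ B`. -/
def HasCompletion {V : Type*} (k : ℕ) (A : Finset (⊤ : SimpleGraph V).Subgraph) : Prop :=
  ∃ B : Finset (⊤ : SimpleGraph V).Subgraph, IsStarDesign k B ∧ A ⊆ B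

/-- The threshold `u(n, k)`. It is an integer and equals `-1` when `2 ≤ n ≤ k`. Integer division
by the positive number `k` is the floor of the quotient, and it is exact in the first case. -/
def starThreshold (n k : ℕ) : ℤ :=
  if n ≡ 1 [MOD k] then 2 * ((n : ℤ) - 1) / (k : ℤ) - 2
  else 2 * (((n : ℤ) - 2) / (k : ℤ)) - 1

/-! Let `R` be the graph of the edges used by the partial design and `Rᶜ` its complement. A
completion splits `Rᶜ` into `k`-stars. Equivalently, each edge of `Rᶜ` is assigned to one of its
ends so that each vertex `v` receives `k * c v` edges, for some function `c`. By Hall's theorem a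
given `c` is realised if `k * ∑ c` is the number of edges and no set `S` spans more than `k * ∑_S c`
of them (`IsCentral.exists_assignment`). The task is to find `c`.

A nearly constant `c` works (`isCentral_of_level`): off a small exceptional set `H`, `c` is a level
`l` plus an excess limited by the degree. A small `S` spans few edges for trivial reasons, and a
large `S` is handled through its complement, so only subsets of `H` need care. `H` collects the
vertices that have about half of all vertices, or more, as neighbours in `R`; the bound on the
number of stars allows at most three. On `H`, `c` is roughly the degree in `Rᶜ` divided by `k`. The
level is 1 or 2 when `n ≥ 2 * k + 3`, and the remaining stars must fit into the total `capacity` of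
the other vertices. The lemmas `exists_level_zero` to `exists_level_three` show that they do; the
tight cases have `n` at most about `4 * k` and are settled by divisibility and polynomial estimates.
Orders `2 * k` and `2 * k + 1` are treated directly.

The obstruction behind the threshold is an edge `xy` of `Rᶜ` both of whose ends have degree less
than `k` in `Rᶜ`: no further star can contain it (`not_hasCompletion`). Producing such an edge takes
more than `u(n, k)` stars (`starThreshold_lt_card`), and `u(n, k) + 1` stars suffice
(`exists_not_hasCompletion`). -/

namespace StarDesign

open Finset

/-! ### Counting adjacent pairs -/

section EdgeCount

variable {V : Type*}

open Classical in
/-- The number of ordered pairs in `X ×ˢ Y` that are adjacent in `G`. -/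
noncomputable def adjCount (G : SimpleGraph V) (X Y : Finset V) : ℤ :=
  ∑ u ∈ X, ∑ v ∈ Y, if G.Adj u v then 1 else 0

variable (G : SimpleGraph V)

lemma adjCount_comm (X Y : Finset V) : adjCount G X Y = adjCount G Y X := by
  unfold adjCount
  rw [sum_comm]
  refine sum_congr rfl fun u _ => sum_congr rfl fun v _ => ?_
  by_cases h : G.Adj u v
  · simp [h, h.symm]
  · simp [h, show ¬G.Adj v u from fun h' => h h'.symm]

lemma adjCount_union_left [DecidableEq V] {X Y : Finset V} (h : Disjoint X Y) (Z : Finset V) :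
    adjCount G (X ∪ Y) Z = adjCount G X Z + adjCount G Y Z :=
  sum_union h

lemma adjCount_union_right [DecidableEq V] {X Y : Finset V} (h : Disjoint X Y) (Z : Finset V) :
    adjCount G Z (X ∪ Y) = adjCount G Z X + adjCount G Z Y := by
  rw [adjCount_comm, adjCount_union_left G h, adjCount_comm G X, adjCount_comm G Y]

lemma adjCount_union_self [DecidableEq V] {X Y : Finset V} (h : Disjoint X Y) :
    adjCount G (X ∪ Y) (X ∪ Y) = adjCount G X X + 2 * adjCount G X Y + adjCount G Y Y := by
  rw [adjCount_union_left G h, adjCount_union_right G h, adjCount_union_right G h,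
    adjCount_comm G Y X]
  ring

lemma adjCount_nonneg (X Y : Finset V) : 0 ≤ adjCount G X Y :=
  sum_nonneg fun _ _ => sum_nonneg fun _ _ => by split <;> simp

lemma adjCount_le (X Y : Finset V) : adjCount G X Y ≤ #X * #Y := by
  classical
  calc adjCount G X Y ≤ ∑ _u ∈ X, ∑ _v ∈ Y, (1 : ℤ) :=
        sum_le_sum fun _ _ => sum_le_sum fun _ _ => by split <;> simp
    _ = _ := by simp

lemma adjCount_self_le (X : Finset V) : adjCount G X X ≤ #X * (#X - 1) := by
  classical
  have : adjCount G X X ≤ ∑ _u ∈ X, ((#X : ℤ) - 1) := by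
    refine sum_le_sum fun u hu => ?_
    calc (∑ v ∈ X, if G.Adj u v then (1 : ℤ) else 0) ≤ ∑ v ∈ X, if v ≠ u then (1 : ℤ) else 0 :=
          sum_le_sum fun v _ => by
            by_cases h : G.Adj u v
            · simp [h, h.ne']
            · simp only [h, if_false]; split <;> simp
      _ = #(X.erase u) := by rw [← sum_filter]; simp [filter_ne']
      _ = _ := by
        rw [card_erase_of_mem hu, Nat.cast_sub (card_pos.2 ⟨u, hu⟩)]; simp
  simpa [mul_sub] using this

lemma adjCount_univ_right [Fintype V] [DecidableRel G.Adj] (X : Finset V) :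
    adjCount G X univ = ∑ v ∈ X, (G.degree v : ℤ) := by
  unfold adjCount
  refine sum_congr rfl fun v _ => ?_
  classical
  calc _ = ∑ w, if w ∈ G.neighborFinset v then (1 : ℤ) else 0 :=
        sum_congr rfl fun w _ => by simp
    _ = _ := by rw [sum_ite_mem]; simp

end EdgeCount

/-! ### Nearly constant central functions -/

section Feasibility

variable {V : Type*} [Fintype V] [DecidableEq V] (G : SimpleGraph V) [DecidableRel G.Adj]

/-- The condition on `c` under which the edges of `G` can be assigned to their endpoints so that
every vertex `v` receives exactly `k * c v` of them. -/
structure IsCentral (k : ℕ) (c : V → ℕ) : Prop where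
  total : adjCount G univ univ = ∑ v, 2 * (k : ℤ) * c v
  subset : ∀ S : Finset V, adjCount G S S ≤ ∑ v ∈ S, 2 * (k : ℤ) * c v

variable {G}

/-- A function is central if it behaves well on the subsets of an exceptional set `H`, while
outside of `H` it exceeds a common level only at vertices of large degree. -/
theorem isCentral_of_level {k : ℕ} {c : V → ℕ} (H : Finset V) (l : ℕ)
    (total : adjCount G univ univ = ∑ v, 2 * (k : ℤ) * c v)
    (lower : ∀ X ⊆ H, adjCount G X X ≤ ∑ v ∈ X, 2 * (k : ℤ) * c v)
    (upper : ∀ X ⊆ H, (∑ v ∈ X, 2 * (k : ℤ) * c v) + adjCount G X X ≤ 2 * adjCount G X univ)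
    (level : ∀ v ∉ H, l ≤ c v)
    (light : ∀ v ∉ H, 2 * (k : ℤ) * c v + Fintype.card V + #H ≤ 2 * G.degree v + 2 * k * l + 3) :
    IsCentral G k c := by
  refine ⟨total, fun S => ?_⟩
  set X := S ∩ H with hX
  set Y := S \ H with hY
  set Z := H \ S with hZ
  set W := (univ \ S) \ H with hW
  have hXY : Disjoint X Y := disjoint_left.2 fun v => by simp [hX, hY]; tauto
  have hZW : Disjoint Z W := disjoint_left.2 fun v => by simp [hZ, hW]; tauto
  have hS : S = X ∪ Y := by ext v; simp [hX, hY]; tauto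
  set T := Z ∪ W with hT
  have hST : Disjoint S T := disjoint_left.2 fun v => by simp [hT, hZ, hW]; tauto
  have huniv : univ = S ∪ T := by ext v; simp [hT, hZ, hW]; tauto
  have hH : #X + #Z = #H := by
    rw [hX, hZ, inter_comm]; exact card_inter_add_card_sdiff H S
  have hn : #X + #Y + (#Z + #W) = Fintype.card V := by
    rw [← card_union_of_disjoint hXY, ← card_union_of_disjoint hZW, ← hS,
      ← card_union_of_disjoint hST, ← huniv, card_univ]
  have hYH : ∀ v ∈ Y, v ∉ H := fun v hv => (mem_sdiff.1 hv).2
  have hWH : ∀ v ∈ W, v ∉ H := fun v hv => (mem_sdiff.1 hv).2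
  have hSS : adjCount G S S = adjCount G X X + 2 * adjCount G X Y + adjCount G Y Y := by
    rw [hS]; exact adjCount_union_self G hXY
  have hTT : adjCount G T T = adjCount G Z Z + 2 * adjCount G Z W + adjCount G W W :=
    adjCount_union_self G hZW
  have hcS : ∑ v ∈ S, 2 * (k : ℤ) * c v = ∑ v ∈ X, 2 * (k : ℤ) * c v + ∑ v ∈ Y, 2 * (k : ℤ) * c v := by
    conv_lhs => rw [hS]
    exact sum_union hXY
  -- For small `S`, each vertex of `Y` accounts for at most `#Y - 1 + 2 * #X ≤ 2 * k * l` pairs,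
  -- which its level pays for. For large `S`, it is equivalent by `total` that the stars centred in
  -- `T` need no more edges than those meeting `T`; there `light` leaves each vertex of `W` a slack
  -- of at least `2 * #Z + #W - 1`.
  by_cases hp : (#Y : ℤ) + 2 * #X ≤ 2 * k * l + 1
  · have h1 := adjCount_le G X Y
    have h2 := adjCount_self_le G Y
    have h3 := lower X inter_subset_right
    have h4 : (#Y : ℤ) * (2 * k * l) ≤ ∑ v ∈ Y, 2 * (k : ℤ) * c v := by
      rw [← nsmul_eq_mul]
      refine card_nsmul_le_sum _ _ _ fun v hv => ?_
      have : (l : ℤ) ≤ c v := by exact_mod_cast level v (hYH v hv)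
      gcongr
    have h5 : (0 : ℤ) ≤ #Y := Int.natCast_nonneg _
    nlinarith
  · have hVV : adjCount G univ univ = adjCount G S S + 2 * adjCount G S T + adjCount G T T := by
      rw [huniv]; exact adjCount_union_self G hST
    have hTV : adjCount G T univ = adjCount G S T + adjCount G T T := by
      rw [huniv, adjCount_union_right G hST, adjCount_comm G T S]
    have hTV' : adjCount G T univ = adjCount G Z univ + ∑ v ∈ W, (G.degree v : ℤ) := by
      rw [hT, adjCount_union_left G hZW, adjCount_univ_right G W]
    have hc : ∑ v, 2 * (k : ℤ) * c v = ∑ v ∈ S, 2 * (k : ℤ) * c v +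
        (∑ v ∈ Z, 2 * (k : ℤ) * c v + ∑ v ∈ W, 2 * (k : ℤ) * c v) := by
      rw [← sum_union hZW, ← sum_union hST, ← huniv]
    have h1 := adjCount_le G Z W
    have h2 := adjCount_self_le G W
    have h3 := upper Z sdiff_subset
    have h4 : ∑ v ∈ W, 2 * (k : ℤ) * c v + #W * ((Fintype.card V : ℤ) + #H - 2 * k * l - 3) ≤
        2 * ∑ v ∈ W, (G.degree v : ℤ) := by
      rw [← nsmul_eq_mul, ← sum_const, ← sum_add_distrib, mul_sum]
      refine sum_le_sum fun v hv => ?_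
      have := light v (hWH v hv)
      linarith
    have h5 : (0 : ℤ) ≤ #W := Int.natCast_nonneg _
    have h6 : 2 * (#Z : ℤ) + #W - 1 ≤ (Fintype.card V : ℤ) + #H - 2 * k * l - 3 := by
      push_cast [← hn, ← hH]
      linarith
    have h7 := mul_le_mul_of_nonneg_left h6 h5
    nlinarith

end Feasibility

/-! ### Assigning edges to endpoints by Hall's theorem -/

section Assignment

lemma two_mul_card_le_adjCount {V : Type*} [DecidableEq V] {G : SimpleGraph V}
    [DecidableRel G.Adj] (F : Finset (Sym2 V)) (hF : ∀ e ∈ F, e ∈ G.edgeSet) (W : Finset V)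
    (hW : ∀ e ∈ F, ∀ v ∈ e, v ∈ W) : 2 * (#F : ℤ) ≤ adjCount G W W := by
  have h1 : ∑ e ∈ F, #{v ∈ W | v ∈ e} = ∑ v ∈ W, #{e ∈ F | v ∈ e} :=
    sum_card_bipartiteAbove_eq_sum_card_bipartiteBelow fun (e : Sym2 V) (v : V) => v ∈ e
  have h2 : ∑ e ∈ F, #{v ∈ W | v ∈ e} = 2 * #F := by
    rw [mul_comm, ← smul_eq_mul, ← sum_const]
    refine sum_congr rfl fun e he => ?_
    rw [← Sym2.card_toFinset_of_not_isDiag e (G.not_isDiag_of_mem_edgeSet (hF e he))]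
    congr 1
    ext v
    simp only [mem_filter, Sym2.mem_toFinset, and_iff_right_iff_imp]
    exact hW e he v
  have h3 : ∀ v ∈ W, (#{e ∈ F | v ∈ e} : ℤ) ≤ ∑ u ∈ W, if G.Adj v u then 1 else 0 := by
    intro v _
    rw [sum_boole, Nat.cast_le]
    refine (card_le_card fun e he => ?_).trans (card_image_le (f := fun u => s(v, u)))
    obtain ⟨heF, u, rfl⟩ := mem_filter.1 he
    exact mem_image.2 ⟨u, mem_filter.2 ⟨hW _ heF u (by simp), hF _ heF⟩, rfl⟩
  have h4 : adjCount G W W = ∑ v ∈ W, ∑ u ∈ W, if G.Adj v u then (1 : ℤ) else 0 :=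
    sum_congr rfl fun v _ => sum_congr rfl fun u _ => by congr
  have h5 := sum_le_sum h3
  rw [← Nat.cast_sum, ← h1, h2, ← h4] at h5
  exact_mod_cast h5

variable {V : Type*} [Fintype V] [DecidableEq V] {G : SimpleGraph V} [DecidableRel G.Adj]

/-- Hall's theorem matches edges to slots, a vertex `v` offering `c v` groups of `k` slots. A set
`F` of edges that covers the vertex set `W` sees all slots at `W` and lies inside `W`, so
`IsCentral.subset` is Hall's condition. Equality of the totals makes the matching bijective. -/
theorem IsCentral.exists_assignment {k : ℕ} {c : V → ℕ} (h : IsCentral G k c) :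
    ∃ f : G.edgeSet ≃ Σ v, Fin (c v) × Fin k, ∀ e : G.edgeSet, (f e).1 ∈ (e : Sym2 V) := by
  classical
  let t : G.edgeSet → Finset (Σ v, Fin (c v) × Fin k) := fun e => {s | s.1 ∈ (e : Sym2 V)}
  have hall : ∀ F : Finset G.edgeSet, #F ≤ #(F.biUnion t) := by
    intro F
    set W : Finset V := {v | ∃ e ∈ F, v ∈ (e : Sym2 V)} with hW
    have h1 : F.biUnion t = W.sigma fun _ => univ := by
      ext s; simp [t, hW]
    have h2 := two_mul_card_le_adjCount (G := G) (F.map ⟨Subtype.val, Subtype.val_injective⟩)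
      (by simp +contextual) W (by
        simp only [mem_map, Function.Embedding.coeFn_mk, hW, mem_filter, mem_univ, true_and]
        rintro _ ⟨e, he, rfl⟩ v hv
        exact ⟨e, he, hv⟩)
    have h3 := h2.trans (h.subset W)
    rw [h1, card_sigma]
    simp only [card_univ, Fintype.card_prod, Fintype.card_fin]
    rw [card_map] at h3
    have h4 : ∑ v ∈ W, 2 * (k : ℤ) * c v = 2 * ((∑ v ∈ W, c v * k : ℕ) : ℤ) := by
      rw [Nat.cast_sum, mul_sum]
      exact sum_congr rfl fun v _ => by push_cast; ring
    rw [h4] at h3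
    exact_mod_cast (mul_le_mul_iff_right₀ (by norm_num : (0 : ℤ) < 2)).1 h3
  obtain ⟨f, hf, hft⟩ := (all_card_le_biUnion_card_iff_exists_injective t).1 hall
  have hcard : Fintype.card G.edgeSet = Fintype.card (Σ v, Fin (c v) × Fin k) := by
    have h1 := h.total
    rw [adjCount_univ_right, ← Nat.cast_sum, G.sum_degrees_eq_twice_card_edges,
      G.edgeFinset_card] at h1
    have h2 : ∑ v, 2 * (k : ℤ) * c v = 2 * ((∑ v, c v * k : ℕ) : ℤ) := by
      rw [Nat.cast_sum, mul_sum]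
      exact sum_congr rfl fun v _ => by push_cast; ring
    rw [h2] at h1
    simp only [Fintype.card_sigma, Fintype.card_prod, Fintype.card_fin]
    push_cast at h1
    zify
    linarith
  refine ⟨Equiv.ofBijective f ((Fintype.bijective_iff_injective_and_card f).2 ⟨hf, hcard⟩),
    fun e => ?_⟩
  simpa [t] using hft e

end Assignment

/-! ### Stars given by centre and leaves -/

section Star

variable {V : Type*}

/-- The star with centre `v` and set of leaves `L`. -/
def star (v : V) (L : Finset V) (hv : v ∉ L) : (⊤ : SimpleGraph V).Subgraph where
  verts := insert v (L : Set V)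
  Adj x y := (x = v ∧ y ∈ L) ∨ (y = v ∧ x ∈ L)
  adj_sub := by
    rintro x y (⟨rfl, h⟩ | ⟨rfl, h⟩)
    · exact (SimpleGraph.top_adj _ _).2 fun e => hv (e ▸ h)
    · exact (SimpleGraph.top_adj _ _).2 fun e => hv (e ▸ h)
  edge_vert := by
    rintro x y (⟨rfl, h⟩ | ⟨rfl, h⟩)
    · exact Set.mem_insert _ _
    · exact Set.mem_insert_of_mem _ h
  symm := ⟨fun x y h => h.symm⟩

lemma star_adj {v : V} {L : Finset V} {hv : v ∉ L} {x y : V} :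
    (star v L hv).Adj x y ↔ (x = v ∧ y ∈ L) ∨ (y = v ∧ x ∈ L) := Iff.rfl

lemma mem_edgeSet_star {v : V} {L : Finset V} {hv : v ∉ L} {e : Sym2 V} :
    e ∈ (star v L hv).edgeSet ↔ ∃ u ∈ L, e = s(v, u) := by
  induction e with
  | h x y =>
    rw [SimpleGraph.Subgraph.mem_edgeSet, star_adj]
    constructor
    · rintro (⟨rfl, h⟩ | ⟨rfl, h⟩)
      · exact ⟨y, h, rfl⟩
      · exact ⟨x, h, Sym2.eq_swap⟩
    · rintro ⟨u, hu, h⟩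
      rcases Sym2.eq_iff.1 h with ⟨rfl, rfl⟩ | ⟨rfl, rfl⟩
      · exact Or.inl ⟨rfl, hu⟩
      · exact Or.inr ⟨rfl, hu⟩

lemma isStar_star {k : ℕ} {v : V} {L : Finset V} (hv : v ∉ L) (hL : #L = k) :
    IsStar k (star v L hv) := by
  classical
  let e := L.equivFinOfCardEq hL
  let g : Fin 1 ⊕ Fin k → (star v L hv).verts :=
    Sum.elim (fun _ => ⟨v, Set.mem_insert _ _⟩) fun i => ⟨e.symm i, Set.mem_insert_of_mem _ (e.symm i).2⟩
  have hne : ∀ i, (e.symm i : V) ≠ v := fun i h => hv (h ▸ (e.symm i).2)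
  have hg : Function.Bijective g := by
    constructor
    · rintro (i | i) (j | j) h
      · rw [Subsingleton.elim i j]
      · exact absurd (congrArg Subtype.val h).symm (hne j)
      · exact absurd (congrArg Subtype.val h) (hne i)
      · have h' := Subtype.ext_iff.1 h
        exact congrArg Sum.inr (e.symm.injective (Subtype.ext h'))
    · rintro ⟨x, rfl | hx⟩
      · exact ⟨Sum.inl 0, rfl⟩
      · exact ⟨Sum.inr (e ⟨x, hx⟩), Subtype.ext (by simp [g])⟩
  refine ⟨RelIso.symm ⟨Equiv.ofBijective g hg, ?_⟩⟩
  rintro (i | i) (j | j) <;> simp [g, star_adj, hne, hv]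

lemma _root_.IsStar.exists_eq_star {k : ℕ} {S : (⊤ : SimpleGraph V).Subgraph} (h : IsStar k S) :
    ∃ (v : V) (L : Finset V) (hv : v ∉ L), #L = k ∧ S = star v L hv := by
  classical
  obtain ⟨φ⟩ := h
  have hadj : ∀ p q, S.Adj (φ.symm p).1 (φ.symm q).1 ↔
      (completeBipartiteGraph (Fin 1) (Fin k)).Adj p q := fun p q => φ.symm.map_rel_iff
  set v : V := (φ.symm (Sum.inl 0)).1 with hvdef
  set L : Finset V := univ.image fun i : Fin k => (φ.symm (Sum.inr i)).1 with hL
  have hv : v ∉ L := by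
    rw [hL, mem_image]
    rintro ⟨i, -, hi⟩
    have := φ.symm.injective (Subtype.ext hi)
    simp at this
  have hinj : Function.Injective fun i : Fin k => (φ.symm (Sum.inr i)).1 := fun i j hij => by
    have := φ.symm.injective (Subtype.ext hij)
    simpa using this
  have hmem : ∀ x : S.verts, ∃ p, φ.symm p = x := fun x => ⟨φ x, φ.symm_apply_apply x⟩
  refine ⟨v, L, hv, by rw [hL, card_image_of_injective _ hinj, card_univ, Fintype.card_fin], ?_⟩
  ext x y
  · constructor
    · intro hx
      obtain ⟨p | p, hp⟩ := hmem ⟨x, hx⟩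
      · left
        rw [hvdef, ← Subsingleton.elim p 0, hp]
      · right
        rw [hL, mem_coe, mem_image]
        exact ⟨p, mem_univ _, by rw [hp]⟩
    · rintro (rfl | hx)
      · exact (φ.symm (Sum.inl 0)).2
      · obtain ⟨i, -, rfl⟩ := mem_image.1 (mem_coe.1 hx)
        exact (φ.symm (Sum.inr i)).2
  · rw [star_adj]
    constructor
    · intro hxy
      obtain ⟨p, hp⟩ := hmem ⟨x, S.edge_vert hxy⟩
      obtain ⟨q, hq⟩ := hmem ⟨y, S.edge_vert hxy.symm⟩
      have hpx : (φ.symm p).1 = x := by rw [hp]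
      have hqy : (φ.symm q).1 = y := by rw [hq]
      rw [← hpx, ← hqy, hadj] at hxy
      rcases p with p | p <;> rcases q with q | q <;> simp at hxy
      · left
        rw [← hpx, ← hqy, Subsingleton.elim p 0, hL]
        exact ⟨rfl, mem_image_of_mem _ (mem_univ _)⟩
      · right
        rw [← hpx, ← hqy, Subsingleton.elim q 0, hL]
        exact ⟨rfl, mem_image_of_mem _ (mem_univ _)⟩
    · rintro (⟨rfl, h⟩ | ⟨rfl, h⟩)
      · obtain ⟨i, -, rfl⟩ := mem_image.1 h
        rw [hvdef, hadj]; simp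
      · obtain ⟨i, -, rfl⟩ := mem_image.1 h
        rw [hvdef, hadj]; simp

end Star

/-! ### The threshold in terms of quotient and remainder of `n - 1` -/

section Threshold

lemma starThreshold_of_pos {k q r : ℕ} (hr : 0 < r) (hrk : r < k) :
    starThreshold (k * q + r + 1) k = 2 * q - 1 := by
  have h : ¬(k * q + r + 1 ≡ 1 [MOD k]) := by
    intro h
    have h1 : k * q + r ≡ 0 [MOD k] := Nat.ModEq.add_right_cancel' 1 h
    rw [Nat.modEq_zero_iff_dvd, Nat.dvd_add_right (dvd_mul_right k q)] at h1
    exact absurd (Nat.le_of_dvd hr h1) (by omega)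
  rw [starThreshold, if_neg h]
  have h2 : ((k * q + r + 1 : ℕ) : ℤ) - 2 = (r - 1 : ℤ) + k * q := by push_cast; ring
  rw [h2, Int.add_mul_ediv_left _ _ (by omega), Int.ediv_eq_zero_of_lt (by omega) (by omega)]
  ring

lemma starThreshold_of_dvd {k q : ℕ} (hk : 0 < k) :
    starThreshold (k * q + 1) k = 2 * q - 2 := by
  have h : k * q + 1 ≡ 1 [MOD k] :=
    Nat.ModEq.add_right 1 ((Nat.modEq_zero_iff_dvd).2 (dvd_mul_right k q))
  rw [starThreshold, if_pos h]
  have h2 : 2 * (((k * q + 1 : ℕ) : ℤ) - 1) = k * (2 * q) := by push_cast; ring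
  rw [h2, Int.mul_ediv_cancel_left _ (by omega)]

end Threshold

/-! ### Degrees in a partial star design -/

section Partial

variable {V : Type*}

/-- The graph of all edges in the members of `A`. -/
def unionGraph (A : Finset (⊤ : SimpleGraph V).Subgraph) : SimpleGraph V where
  Adj x y := ∃ S ∈ A, S.Adj x y
  symm := ⟨fun _ _ ⟨S, hS, h⟩ => ⟨S, hS, h.symm⟩⟩
  loopless := ⟨fun _ ⟨_, _, h⟩ => h.ne rfl⟩

lemma unionGraph_adj {A : Finset (⊤ : SimpleGraph V).Subgraph} {x y : V} :
    (unionGraph A).Adj x y ↔ ∃ S ∈ A, S.Adj x y := Iff.rfl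

lemma isPartialStarDesign_of_disjoint {k : ℕ} {A : Finset (⊤ : SimpleGraph V).Subgraph}
    (hA : ∀ S ∈ A, IsStar k S)
    (hd : ∀ S ∈ A, ∀ T ∈ A, S ≠ T → Disjoint S.edgeSet T.edgeSet) : IsPartialStarDesign k A :=
  ⟨⨆ S ∈ A, S, hA, hd, by simp⟩

lemma adj_unique {A : Finset (⊤ : SimpleGraph V).Subgraph}
    (hd : ∀ S ∈ A, ∀ T ∈ A, S ≠ T → Disjoint S.edgeSet T.edgeSet)
    {S T : (⊤ : SimpleGraph V).Subgraph} (hS : S ∈ A) (hT : T ∈ A) {x y : V} (h : S.Adj x y)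
    (h' : T.Adj x y) : S = T := by
  by_contra hne
  exact Set.disjoint_left.1 (hd S hS T hT hne) (SimpleGraph.Subgraph.mem_edgeSet.2 h)
    (SimpleGraph.Subgraph.mem_edgeSet.2 h')

variable [Fintype V] [DecidableEq V]

/-- In a partial star design, a vertex has one edge for each star in which it is a leaf and `k`
edges for each star of which it is the centre. -/
lemma exists_centre_leaves [Nonempty V] {k : ℕ} {A : Finset (⊤ : SimpleGraph V).Subgraph}
    [DecidableRel (unionGraph A).Adj] (hA : ∀ S ∈ A, IsStar k S)
    (hd : ∀ S ∈ A, ∀ T ∈ A, S ≠ T → Disjoint S.edgeSet T.edgeSet) :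
    ∃ (z : (⊤ : SimpleGraph V).Subgraph → V) (L : (⊤ : SimpleGraph V).Subgraph → Finset V),
      (∀ S ∈ A, z S ∉ L S ∧ #(L S) = k ∧ ∀ x ∈ L S, (unionGraph A).Adj (z S) x) ∧
      ∀ x, (unionGraph A).degree x =
        ∑ S ∈ A, if x = z S then k else if x ∈ L S then 1 else 0 := by
  have hex : ∀ S : (⊤ : SimpleGraph V).Subgraph, ∃ (v : V) (L : Finset V), S ∈ A →
      ∃ hv : v ∉ L, #L = k ∧ S = star v L hv := fun S => by
    by_cases hS : S ∈ A
    · obtain ⟨v, L, hv, hL, h⟩ := (hA S hS).exists_eq_star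
      exact ⟨v, L, fun _ => ⟨hv, hL, h⟩⟩
    · exact ⟨Classical.arbitrary V, ∅, fun h => absurd h hS⟩
  choose z L h using hex
  have hadj : ∀ S ∈ A, ∀ x y, S.Adj x y ↔ (x = z S ∧ y ∈ L S) ∨ (y = z S ∧ x ∈ L S) := by
    intro S hS x y
    obtain ⟨hv, -, he⟩ := h S hS
    conv_lhs => rw [he]
    exact star_adj
  refine ⟨z, L, fun S hS => ?_, fun x => ?_⟩
  · obtain ⟨hv, hk, -⟩ := h S hS
    exact ⟨hv, hk, fun x hx => ⟨S, hS, (hadj S hS _ _).2 (Or.inl ⟨rfl, hx⟩)⟩⟩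
  · have hN : (unionGraph A).neighborFinset x =
        A.biUnion fun S => if x = z S then L S else if x ∈ L S then {z S} else ∅ := by
      ext y
      rw [SimpleGraph.mem_neighborFinset, unionGraph_adj, mem_biUnion]
      refine exists_congr fun S => and_congr_right fun hS => ?_
      obtain ⟨hv, -, -⟩ := h S hS
      rw [hadj S hS]
      by_cases hx : x = z S
      · subst hx; simp [hv]
      · by_cases hxL : x ∈ L S <;> simp [hx, hxL]
    rw [← SimpleGraph.card_neighborFinset_eq_degree, hN, card_biUnion]
    · refine sum_congr rfl fun S hS => ?_
      obtain ⟨-, hk, -⟩ := h S hS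
      split_ifs <;> simp [hk]
    · intro S hS T hT hne
      rw [Function.onFun, disjoint_left]
      intro y hy hy'
      have key : ∀ S ∈ A, y ∈ (if x = z S then L S else if x ∈ L S then {z S} else ∅) →
          S.Adj x y := by
        intro S hS hy
        rw [hadj S hS]
        split_ifs at hy with h1 h2
        · exact Or.inl ⟨h1, hy⟩
        · exact Or.inr ⟨mem_singleton.1 hy, h2⟩
        · simp at hy
      exact hne (adj_unique hd hS hT (key S hS hy) (key T hT hy'))

variable {k : ℕ} {A : Finset (⊤ : SimpleGraph V).Subgraph} [DecidableRel (unionGraph A).Adj]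

lemma sum_degree_unionGraph [Nonempty V] (hA : ∀ S ∈ A, IsStar k S)
    (hd : ∀ S ∈ A, ∀ T ∈ A, S ≠ T → Disjoint S.edgeSet T.edgeSet) :
    ∑ v, (unionGraph A).degree v = 2 * (k * #A) := by
  obtain ⟨z, L, h, hdeg⟩ := exists_centre_leaves hA hd
  simp only [hdeg]
  rw [sum_comm, ← mul_assoc, mul_comm, ← smul_eq_mul, ← sum_const]
  refine sum_congr rfl fun S hS => ?_
  obtain ⟨hv, hk, -⟩ := h S hS
  have : ∀ x, (if x = z S then k else if x ∈ L S then 1 else 0) =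
      (if x = z S then k else 0) + if x ∈ L S then 1 else 0 := by
    intro x
    by_cases hx : x = z S
    · subst hx; simp [hv]
    · simp [hx]
  simp only [this, sum_add_distrib]
  simp [hk, two_mul]

/-- Two vertices that are not joined by an edge of the design can both have small degree in its
complement only if the design has many stars. -/
lemma starThreshold_lt_card (hk : 2 ≤ k) (hA : ∀ S ∈ A, IsStar k S)
    (hd : ∀ S ∈ A, ∀ T ∈ A, S ≠ T → Disjoint S.edgeSet T.edgeSet) {x y : V} (hxy : x ≠ y)
    (hadj : ¬(unionGraph A).Adj x y) (hx : Fintype.card V ≤ (unionGraph A).degree x + k)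
    (hy : Fintype.card V ≤ (unionGraph A).degree y + k) :
    starThreshold (Fintype.card V) k < #A := by
  have : Nonempty V := ⟨x⟩
  obtain ⟨z, L, h, hdeg⟩ := exists_centre_leaves hA hd
  have key : ∀ x, (unionGraph A).degree x =
      #{S ∈ A | z S = x} * k + #{S ∈ A | x ∈ L S} := by
    intro x
    rw [hdeg, card_filter, card_filter, sum_mul, ← sum_add_distrib]
    refine sum_congr rfl fun S hS => ?_
    obtain ⟨hv, -, -⟩ := h S hS
    by_cases hx : x = z S
    · subst hx; simp [hv]
    · simp [hx, Ne.symm hx]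
  have hcount : ∀ w, (w = x ∨ w = y) →
      #{S ∈ A | z S = x} + #{S ∈ A | z S = y} + #{S ∈ A | w ∈ L S} ≤ #A := by
    intro w hw
    classical
    -- A star with one of `x`, `y` as a leaf and the other as centre would contain the edge `xy`.
    have hnot : ∀ S ∈ A, w ∈ L S → z S ≠ x ∧ z S ≠ y := by
      intro S hS hwS
      obtain ⟨hv, -, hadj'⟩ := h S hS
      have h1 := hadj' w hwS
      rcases hw with rfl | rfl
      · exact ⟨fun e => hv (e ▸ hwS), fun e => hadj (e ▸ h1).symm⟩
      · exact ⟨fun e => hadj (e ▸ h1), fun e => hv (e ▸ hwS)⟩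
    rw [← card_union_of_disjoint, ← card_union_of_disjoint]
    · refine card_le_card fun S hS => ?_
      simp only [mem_union, mem_filter] at hS
      tauto
    · rw [disjoint_left]
      intro S hS hS'
      simp only [mem_union, mem_filter] at hS hS'
      have := hnot S hS'.1 hS'.2
      tauto
    · rw [disjoint_left]
      intro S hS hS'
      simp only [mem_filter] at hS hS'
      exact hxy (hS.2.symm.trans hS'.2)
  have h1 := hcount x (Or.inl rfl)
  have h2 := hcount y (Or.inr rfl)
  rw [key] at hx hy
  have hn : 2 ≤ Fintype.card V := Fintype.one_lt_card_iff.2 ⟨x, y, hxy⟩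
  generalize #{S ∈ A | z S = x} = p at *
  generalize #{S ∈ A | z S = y} = q at *
  generalize #{S ∈ A | x ∈ L S} = b at *
  generalize #{S ∈ A | y ∈ L S} = b' at *
  generalize Fintype.card V = n at *
  -- Of `x` and `y`, take the one that is the centre of fewer stars: `m` counts these stars and `c`
  -- those in which it is a leaf.
  obtain ⟨m, c, hc, hb, hm⟩ : ∃ m c, 2 * m + c ≤ #A ∧ n ≤ m * k + c + k ∧ 0 ≤ m := by
    rcases le_total p q with hpq | hpq
    · exact ⟨p, b, by omega, hx, Nat.zero_le _⟩
    · exact ⟨q, b', by omega, hy, Nat.zero_le _⟩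
  obtain ⟨s, r, hr, rfl⟩ : ∃ s r, r < k ∧ n = k * s + r + 1 :=
    ⟨(n - 1) / k, (n - 1) % k, Nat.mod_lt _ (by omega), by
      rw [Nat.div_add_mod]; omega⟩
  -- Covering `k` edges by leaf incidences costs `k ≥ 2` stars, no cheaper than one more star at
  -- each of `x` and `y`.
  have hfew : m < s → 2 * s + r ≤ #A + 1 := by
    intro hms
    obtain ⟨d, rfl⟩ := Nat.exists_eq_add_of_lt hms
    have : 2 * d ≤ k * d := Nat.mul_le_mul_right d hk
    nlinarith
  rcases Nat.eq_zero_or_pos r with rfl | hr0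
  · rw [add_zero, starThreshold_of_dvd (by omega)]
    by_cases hms : m < s
    · have := hfew hms; omega
    · omega
  · rw [starThreshold_of_pos hr0 hr]
    by_cases hms : m < s
    · have := hfew hms; omega
    · omega

end Partial

/-! ### From central functions to completions, and the obstruction -/

section Completion

variable {V : Type*} [Fintype V] [DecidableEq V]

/-- The edges of a graph with a central function can be partitioned into stars. -/
lemma IsCentral.exists_stars {G : SimpleGraph V} [DecidableRel G.Adj] {k : ℕ} {c : V → ℕ}
    (h : IsCentral G k c) :
    ∃ B : Finset (⊤ : SimpleGraph V).Subgraph, (∀ S ∈ B, IsStar k S) ∧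
      (∀ S ∈ B, ∀ T ∈ B, S ≠ T → Disjoint S.edgeSet T.edgeSet) ∧
      ∀ e, e ∈ G.edgeSet ↔ ∃ S ∈ B, e ∈ S.edgeSet := by
  classical
  obtain ⟨f, hf⟩ := h.exists_assignment
  have hf' : ∀ (p : Σ v, Fin (c v)) (i : Fin k),
      p.1 ∈ (f.symm ⟨p.1, p.2, i⟩ : Sym2 V) := fun p i => by
    simpa using hf (f.symm ⟨p.1, p.2, i⟩)
  let o : (Σ v, Fin (c v)) → Fin k → V := fun p i => Sym2.Mem.other (hf' p i)
  have ho : ∀ p i, s(p.1, o p i) = (f.symm ⟨p.1, p.2, i⟩ : Sym2 V) := fun p i =>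
    Sym2.other_spec (hf' p i)
  have hinj : ∀ p, Function.Injective (o p) := by
    intro p i j hij
    have h1 : (f.symm ⟨p.1, p.2, i⟩ : Sym2 V) = f.symm ⟨p.1, p.2, j⟩ := by
      rw [← ho, ← ho, hij]
    simpa using f.symm.injective (Subtype.ext h1)
  have hnot : ∀ p : Σ v, Fin (c v), p.1 ∉ univ.image (o p) := by
    intro p hp
    obtain ⟨i, -, hi⟩ := mem_image.1 hp
    have h1 : s(p.1, o p i) ∈ G.edgeSet := by rw [ho]; exact (f.symm _).2
    rw [hi] at h1
    exact G.loopless.irrefl _ h1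
  let st : (Σ v, Fin (c v)) → (⊤ : SimpleGraph V).Subgraph := fun p =>
    star p.1 (univ.image (o p)) (hnot p)
  have hst : ∀ p (e : Sym2 V), e ∈ (st p).edgeSet ↔ ∃ i, e = f.symm ⟨p.1, p.2, i⟩ := by
    intro p e
    rw [mem_edgeSet_star]
    constructor
    · rintro ⟨u, hu, rfl⟩
      obtain ⟨i, -, rfl⟩ := mem_image.1 hu
      exact ⟨i, ho p i⟩
    · rintro ⟨i, rfl⟩
      exact ⟨o p i, mem_image_of_mem _ (mem_univ i), (ho p i).symm⟩
  refine ⟨univ.image st, ?_, ?_, ?_⟩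
  · intro S hS
    obtain ⟨p, -, rfl⟩ := mem_image.1 hS
    exact isStar_star _ (by rw [card_image_of_injective _ (hinj p), card_univ, Fintype.card_fin])
  · intro S hS T hT hne
    obtain ⟨p, -, rfl⟩ := mem_image.1 hS
    obtain ⟨q, -, rfl⟩ := mem_image.1 hT
    rw [Set.disjoint_left]
    intro e he he'
    obtain ⟨i, rfl⟩ := (hst p e).1 he
    obtain ⟨j, hj⟩ := (hst q _).1 he'
    have h1 := f.symm.injective (Subtype.ext hj)
    apply hne
    congr 1
    obtain ⟨v, a⟩ := p
    obtain ⟨w, b⟩ := q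
    simp only [Sigma.mk.injEq] at h1 ⊢
    obtain ⟨rfl, h2⟩ := h1
    simpa using (Prod.ext_iff.1 (eq_of_heq h2)).1
  · intro e
    constructor
    · intro he
      refine ⟨st ⟨(f ⟨e, he⟩).1, (f ⟨e, he⟩).2.1⟩, mem_image_of_mem _ (mem_univ _), ?_⟩
      rw [hst]
      exact ⟨(f ⟨e, he⟩).2.2, by simp⟩
    · rintro ⟨S, hS, he⟩
      obtain ⟨p, -, rfl⟩ := mem_image.1 hS
      obtain ⟨i, rfl⟩ := (hst p e).1 he
      exact (f.symm _).2

lemma IsCentral.hasCompletion {k : ℕ} {A : Finset (⊤ : SimpleGraph V).Subgraph}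
    [DecidableRel (unionGraph A).Adj] (hA : ∀ S ∈ A, IsStar k S)
    (hd : ∀ S ∈ A, ∀ T ∈ A, S ≠ T → Disjoint S.edgeSet T.edgeSet) {c : V → ℕ}
    (h : IsCentral (unionGraph A)ᶜ k c) : HasCompletion k A := by
  classical
  obtain ⟨B, hB, hdB, hGB⟩ := h.exists_stars
  have hAB : ∀ S ∈ A, ∀ T ∈ B, Disjoint S.edgeSet T.edgeSet := by
    intro S hS T hT
    rw [Set.disjoint_left]
    intro e he he'
    have h1 := (hGB e).2 ⟨T, hT, he'⟩
    induction e with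
    | h x y =>
      rw [SimpleGraph.mem_edgeSet, SimpleGraph.compl_adj] at h1
      exact h1.2 ⟨S, hS, he⟩
  refine ⟨A ∪ B, ⟨?_, ?_, ?_⟩, subset_union_left⟩
  · intro S hS
    rcases mem_union.1 hS with h | h
    exacts [hA S h, hB S h]
  · intro S hS T hT hne
    rcases mem_union.1 hS with h | h <;> rcases mem_union.1 hT with h' | h'
    exacts [hd S h T h' hne, hAB S h T h', (hAB T h' S h).symm, hdB S h T h' hne]
  · ext e
    simp only [Set.mem_iUnion, exists_prop]
    constructor
    · rintro ⟨S, -, he⟩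
      have := S.edgeSet_subset he
      induction e with
      | h x y => simpa using this
    · intro he
      induction e with
      | h x y =>
        have hxy : x ≠ y := by simpa using he
        by_cases hR : (unionGraph A).Adj x y
        · obtain ⟨S, hS, h⟩ := hR
          exact ⟨S, mem_union_left _ hS, h⟩
        · obtain ⟨S, hS, h⟩ := (hGB s(x, y)).1 (by
            rw [SimpleGraph.mem_edgeSet, SimpleGraph.compl_adj]
            exact ⟨hxy, hR⟩)
          exact ⟨S, mem_union_right _ hS, h⟩

/-- An edge outside of the design whose ends both have small degree outside of the design
obstructs completion. -/
lemma not_hasCompletion {k : ℕ} {A : Finset (⊤ : SimpleGraph V).Subgraph} {x y : V}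
    (hxy : x ≠ y) (hA : ∀ S ∈ A, ¬S.Adj x y) {X Y : Finset V}
    (hX : ∀ u ∈ X, ∃ S ∈ A, S.Adj x u) (hY : ∀ u ∈ Y, ∃ S ∈ A, S.Adj y u)
    (hXk : Fintype.card V ≤ #X + k) (hYk : Fintype.card V ≤ #Y + k) : ¬HasCompletion k A := by
  rintro ⟨B, ⟨hB, hd, hu⟩, hAB⟩
  have h1 : s(x, y) ∈ ⋃ S ∈ B, S.edgeSet := by
    rw [hu, SimpleGraph.Subgraph.mem_edgeSet]
    simpa using hxy
  simp only [Set.mem_iUnion, exists_prop] at h1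
  obtain ⟨S, hS, hSxy⟩ := h1
  obtain ⟨v, L, hv, hL, rfl⟩ := (hB S hS).exists_eq_star
  -- The star through `xy` is not in `A`, so its `k` leaves avoid both its centre and `Z`.
  have key : ∀ Z : Finset V, (∀ u ∈ Z, ∃ S ∈ A, S.Adj v u) → ¬Fintype.card V ≤ #Z + k := by
    intro Z hZ hZk
    have hdis : Disjoint Z L := by
      rw [disjoint_left]
      intro u huZ huL
      obtain ⟨T, hT, hTu⟩ := hZ u huZ
      have h2 := adj_unique hd hS (hAB hT) (star_adj.2 (Or.inl ⟨rfl, huL⟩)) hTu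
      exact hA _ (h2 ▸ hT) hSxy
    have hvn : v ∉ Z ∪ L := by
      rw [mem_union, not_or]
      refine ⟨fun hvZ => ?_, hv⟩
      obtain ⟨T, -, hT⟩ := hZ v hvZ
      exact hT.ne rfl
    have h2 := card_le_univ (insert v (Z ∪ L))
    rw [card_insert_of_notMem hvn, card_union_of_disjoint hdis, hL] at h2
    omega
  rcases star_adj.1 (SimpleGraph.Subgraph.mem_edgeSet.1 hSxy) with ⟨rfl, -⟩ | ⟨rfl, -⟩
  · exact key X hX hXk
  · exact key Y hY hYk

end Completion

/-! ### Designs with `u(n, k) + 1` stars and no completion -/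

section Sharpness

lemma disjoint_edgeSet_star {V : Type*} {v w : V} {L M : Finset V} {hv : v ∉ L} {hw : w ∉ M}
    (h1 : v = w → Disjoint L M) (h2 : w ∈ L → v ∈ M → False) :
    Disjoint (star v L hv).edgeSet (star w M hw).edgeSet := by
  rw [Set.disjoint_left]
  intro e he he'
  obtain ⟨u, hu, rfl⟩ := mem_edgeSet_star.1 he
  obtain ⟨u', hu', h⟩ := mem_edgeSet_star.1 he'
  rcases Sym2.eq_iff.1 h with ⟨rfl, rfl⟩ | ⟨rfl, rfl⟩
  · exact disjoint_left.1 (h1 rfl) hu hu'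
  · exact h2 hu hu'

lemma exists_partialStarDesign_of_family {V ι : Type*} [Fintype ι] {k : ℕ} (hk : 0 < k)
    (st : ι → (⊤ : SimpleGraph V).Subgraph) (hst : ∀ i, IsStar k (st i))
    (hd : ∀ i j, i ≠ j → Disjoint (st i).edgeSet (st j).edgeSet) :
    ∃ A : Finset (⊤ : SimpleGraph V).Subgraph, IsPartialStarDesign k A ∧ #A = Fintype.card ι ∧
      ∀ S, S ∈ A ↔ ∃ i, st i = S := by
  classical
  have hinj : Function.Injective st := by
    intro i j hij
    by_contra hne
    obtain ⟨v, L, hv, hL, h⟩ := (hst i).exists_eq_star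
    obtain ⟨u, hu⟩ := card_pos.1 (hL ▸ hk)
    have h1 : s(v, u) ∈ (st i).edgeSet := by rw [h]; exact mem_edgeSet_star.2 ⟨u, hu, rfl⟩
    exact Set.disjoint_left.1 (hd i j hne) h1 (hij ▸ h1)
  refine ⟨univ.image st, isPartialStarDesign_of_disjoint ?_ ?_, ?_, by simp⟩
  · intro S hS
    obtain ⟨i, -, rfl⟩ := mem_image.1 hS
    exact hst i
  · intro S hS T hT hne
    obtain ⟨i, -, rfl⟩ := mem_image.1 hS
    obtain ⟨j, -, rfl⟩ := mem_image.1 hT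
    exact hd i j fun h => hne (h ▸ rfl)
  · rw [card_image_of_injective _ hinj, card_univ]

/-- The `j`-th of the consecutive blocks of `k` numbers that start at `2`. -/
def block (n k j : ℕ) : Finset (Fin n) :=
  {u | 2 + j * k ≤ (u : ℕ) ∧ (u : ℕ) < 2 + (j + 1) * k}

lemma mem_block {n k j : ℕ} {u : Fin n} :
    u ∈ block n k j ↔ 2 + j * k ≤ (u : ℕ) ∧ (u : ℕ) < 2 + (j + 1) * k := by
  simp [block]

lemma card_filter_fin_Ico {n a b : ℕ} (hb : b ≤ n) :
    #{u : Fin n | a ≤ (u : ℕ) ∧ (u : ℕ) < b} = b - a := by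
  rw [← Nat.card_Ico a b, ← card_map Fin.valEmbedding]
  congr 1
  ext x
  simp only [mem_map, mem_filter, mem_univ, true_and, Fin.valEmbedding_apply, mem_Ico]
  exact ⟨by rintro ⟨u, hu, rfl⟩; exact hu, fun h => ⟨⟨x, by omega⟩, h, rfl⟩⟩

lemma card_block {n k j : ℕ} (h : 2 + (j + 1) * k ≤ n) : #(block n k j) = k := by
  rw [block, card_filter_fin_Ico h, add_mul]
  omega

lemma disjoint_block {n k i j : ℕ} (h : i ≠ j) : Disjoint (block n k i) (block n k j) := by
  rw [disjoint_left]
  intro u hu hu'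
  rw [mem_block] at hu hu'
  rcases lt_or_gt_of_ne h with h | h
  · have := Nat.mul_le_mul_right k (Nat.succ_le_of_lt h)
    simp only [Nat.succ_eq_add_one] at this
    omega
  · have := Nat.mul_le_mul_right k (Nat.succ_le_of_lt h)
    simp only [Nat.succ_eq_add_one] at this
    omega

lemma exists_mem_block {n k m : ℕ} {u : Fin n} (h1 : 2 ≤ (u : ℕ)) (h2 : (u : ℕ) < 2 + m * k) :
    ∃ j : Fin m, u ∈ block n k j := by
  have hk : 0 < k := Nat.pos_of_ne_zero fun h => by subst h; omega
  have hlt : ((u : ℕ) - 2) / k < m := (Nat.div_lt_iff_lt_mul hk).2 (by omega)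
  refine ⟨⟨_, hlt⟩, mem_block.2 ⟨?_, ?_⟩⟩
  · have := Nat.div_mul_le_self ((u : ℕ) - 2) k
    simp only
    omega
  · have := Nat.lt_div_mul_add (a := (u : ℕ) - 2) hk
    simp only [add_mul]
    omega

/-- Stars centred at the vertices `0` and `1` whose leaves form the blocks. -/
def blockStar {n k m : ℕ} (hn : 2 + m * k ≤ n) (p : Fin 2 × Fin m) :
    (⊤ : SimpleGraph (Fin n)).Subgraph :=
  star ⟨p.1, by omega⟩ (block n k p.2) (by rw [mem_block]; simp; omega)

lemma isStar_blockStar {n k m : ℕ} (hn : 2 + m * k ≤ n) (p : Fin 2 × Fin m) :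
    IsStar k (blockStar hn p) := by
  refine isStar_star _ (card_block ?_)
  have := Nat.mul_le_mul_right k (Nat.succ_le_of_lt p.2.2)
  simp only [Nat.succ_eq_add_one] at this
  omega

lemma disjoint_blockStar {n k m : ℕ} (hn : 2 + m * k ≤ n) {p q : Fin 2 × Fin m} (h : p ≠ q) :
    Disjoint (blockStar hn p).edgeSet (blockStar hn q).edgeSet := by
  refine disjoint_edgeSet_star (fun h1 => ?_) fun h1 _ => ?_
  · refine disjoint_block fun h2 => h (Prod.ext (Fin.ext ?_) (Fin.ext h2))
    simpa using h1
  · rw [mem_block] at h1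
    simp only at h1
    omega

lemma exists_blockStar_adj {n k m : ℕ} (hn : 2 + m * k ≤ n) (b : Fin 2) {u : Fin n}
    (h1 : 2 ≤ (u : ℕ)) (h2 : (u : ℕ) < 2 + m * k) :
    ∃ p, (blockStar hn p).Adj ⟨b, by omega⟩ u := by
  obtain ⟨j, hj⟩ := exists_mem_block h1 h2
  exact ⟨(b, j), Or.inl ⟨rfl, hj⟩⟩

lemma not_blockStar_adj {n k m : ℕ} (hn : 2 + m * k ≤ n) (p : Fin 2 × Fin m) {x y : Fin n}
    (hx : (x : ℕ) < 2) (hy : (y : ℕ) < 2) : ¬(blockStar hn p).Adj x y := by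
  rintro (⟨-, h⟩ | ⟨-, h⟩) <;> · rw [mem_block] at h; omega

theorem exists_not_hasCompletion {k n : ℕ} (hk : 2 ≤ k) (hn : 1 < n) :
    ∃ A : Finset (⊤ : SimpleGraph (Fin n)).Subgraph, IsPartialStarDesign k A ∧
      (#A : ℤ) = starThreshold n k + 1 ∧ ¬HasCompletion k A := by
  obtain ⟨q, r, hr, hqr⟩ : ∃ q r, r < k ∧ n = k * q + r + 1 :=
    ⟨(n - 1) / k, (n - 1) % k, Nat.mod_lt _ (by omega), by rw [Nat.div_add_mod]; omega⟩
  have h01 : (⟨0, by omega⟩ : Fin n) ≠ ⟨1, by omega⟩ := by simp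
  rcases Nat.eq_zero_or_pos r with rfl | hr0
  · obtain ⟨m, rfl⟩ : ∃ m, q = m + 1 := Nat.exists_eq_succ_of_ne_zero (by rintro rfl; omega)
    have hm : n = m * k + k + 1 := by rw [hqr]; ring
    have hmn : 2 + m * k ≤ n := by omega
    -- With only `m = q - 1` blocks per centre, `0` and `1` each still have one edge too many
    -- outside the design. One star centred at `n - 1` uses an edge at both; its other `k - 2`
    -- leaves are the vertices beyond the blocks.
    set L : Finset (Fin n) := {u | (u : ℕ) < 2 ∨ m * k + 2 ≤ u ∧ (u : ℕ) < n - 1} with hL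
    have hzL : (⟨n - 1, by omega⟩ : Fin n) ∉ L := by simp [hL]; omega
    have hLk : #L = k := by
      rw [hL, filter_or, card_union_of_disjoint]
      · have h1 := card_filter_fin_Ico (n := n) (a := 0) (b := 2) (by omega)
        simp only [Nat.zero_le, true_and] at h1
        rw [h1, card_filter_fin_Ico (by omega)]
        omega
      · rw [disjoint_left]
        intro u hu hu'
        simp only [mem_filter, mem_univ, true_and] at hu hu'
        omega
    have hd0 : ∀ p, Disjoint (blockStar hmn p).edgeSet (star _ L hzL).edgeSet := by
      intro p
      refine disjoint_edgeSet_star (fun h1 => ?_) fun h1 _ => ?_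
      · have h2 := congrArg Fin.val h1
        simp only at h2
        omega
      · rw [mem_block] at h1
        have := Nat.mul_le_mul_right k (Nat.succ_le_of_lt p.2.2)
        simp only [Nat.succ_eq_add_one] at this h1
        omega
    obtain ⟨A, hA, hcard, hmem⟩ := exists_partialStarDesign_of_family (ι := Option (Fin 2 × Fin m))
      (by omega : 0 < k) (fun i => i.elim (star _ L hzL) (blockStar hmn))
      (by rintro (_ | p); exacts [isStar_star hzL hLk, isStar_blockStar hmn p])
      (by
        rintro (_ | p) (_ | q) hpq
        · exact absurd rfl hpq
        · exact (hd0 q).symm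
        · exact hd0 p
        · exact disjoint_blockStar hmn fun h => hpq (h ▸ rfl))
    let Z : Finset (Fin n) := {u : Fin n | 2 ≤ (u : ℕ) ∧ (u : ℕ) < 2 + m * k}
    let Z' : Finset (Fin n) := {⟨n - 1, by omega⟩}
    refine ⟨A, hA, ?_, not_hasCompletion h01 (X := Z ∪ Z') (Y := Z ∪ Z') ?_ ?_ ?_ ?_ ?_⟩
    · rw [hcard, hqr, add_zero, starThreshold_of_dvd (by omega)]
      simp only [Fintype.card_option, Fintype.card_prod, Fintype.card_fin]
      push_cast
      ring
    · intro S hS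
      obtain ⟨_ | p, rfl⟩ := (hmem S).1 hS
      · rintro (⟨h, -⟩ | ⟨h, -⟩)
        · have := congrArg Fin.val h; simp only at this; omega
        · have := congrArg Fin.val h; simp only at this; omega
      · exact not_blockStar_adj hmn p (by simp) (by simp)
    · intro u hu
      rcases mem_union.1 hu with h | h
      · simp only [Z, mem_filter, mem_univ, true_and] at h
        obtain ⟨p, hp⟩ := exists_blockStar_adj hmn 0 h.1 h.2
        exact ⟨_, (hmem _).2 ⟨some p, rfl⟩, hp⟩
      · rw [mem_singleton] at h
        exact ⟨_, (hmem _).2 ⟨none, rfl⟩, Or.inr ⟨h, by simp [hL]⟩⟩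
    · intro u hu
      rcases mem_union.1 hu with h | h
      · simp only [Z, mem_filter, mem_univ, true_and] at h
        obtain ⟨p, hp⟩ := exists_blockStar_adj hmn 1 h.1 h.2
        exact ⟨_, (hmem _).2 ⟨some p, rfl⟩, hp⟩
      · rw [mem_singleton] at h
        exact ⟨_, (hmem _).2 ⟨none, rfl⟩, Or.inr ⟨h, by simp [hL]⟩⟩
    all_goals
      rw [card_union_of_disjoint, card_filter_fin_Ico hmn, card_singleton, Fintype.card_fin]
      · omega
      · rw [disjoint_singleton_right]
        simp [Z]
        omega
  -- The `2 * q` block stars leave `0` and `1` with `r < k` further edges each. For `n ≤ k` there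
  -- are no blocks and `A` is empty, in accordance with the threshold `-1`.
  · have hmn : 2 + q * k ≤ n := by rw [hqr, mul_comm]; omega
    obtain ⟨A, hA, hcard, hmem⟩ := exists_partialStarDesign_of_family (by omega : 0 < k)
      (blockStar hmn) (isStar_blockStar hmn) fun p q hpq => disjoint_blockStar hmn hpq
    refine ⟨A, hA, ?_, not_hasCompletion h01 (X := {u | 2 ≤ (u : ℕ) ∧ (u : ℕ) < 2 + q * k})
      (Y := {u | 2 ≤ (u : ℕ) ∧ (u : ℕ) < 2 + q * k}) ?_ ?_ ?_ ?_ ?_⟩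
    · rw [hcard, hqr, starThreshold_of_pos hr0 hr]
      simp
    · intro S hS
      obtain ⟨p, rfl⟩ := (hmem S).1 hS
      exact not_blockStar_adj hmn p (by simp) (by simp)
    · intro u hu
      simp only [mem_filter, mem_univ, true_and] at hu
      obtain ⟨p, hp⟩ := exists_blockStar_adj hmn 0 hu.1 hu.2
      exact ⟨_, (hmem _).2 ⟨p, rfl⟩, hp⟩
    · intro u hu
      simp only [mem_filter, mem_univ, true_and] at hu
      obtain ⟨p, hp⟩ := exists_blockStar_adj hmn 1 hu.1 hu.2
      exact ⟨_, (hmem _).2 ⟨p, rfl⟩, hp⟩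
    all_goals
      rw [card_filter_fin_Ico hmn, Fintype.card_fin, hqr, mul_comm k q]
      omega

end Sharpness

/-! ### Existence of a suitable level -/

section Arithmetic

/-! In this section `N + 1` is the number of vertices, `a` is the number of stars, `R` is the
number of further stars, of which `c` are centred in a set of `h` exceptional vertices with `D`
incident edges, and `Q` bounds the number of vertices that can be centres of additional stars. -/

/-- The parameters of a partial star design on at least `2 * k + 3` vertices with few stars. -/
structure Parameters (k N a R : ℤ) : Prop where
  two_le : 2 ≤ k
  le : 2 * k + 2 ≤ N
  nonneg : 0 ≤ a
  total : N * (N + 1) = 2 * k * (R + a)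
  mul_le : k * a ≤ 2 * N - k - 2
  le_three : N < 3 * k → a ≤ 3
  le_four : N = 3 * k → a ≤ 4
  le_five : N < 4 * k → a ≤ 5
  le_six : N = 4 * k → a ≤ 6

variable {k N a R c D ρ Q : ℤ}

/-- In `mul_le`, the term `-2` comes from `r ≥ 1` or, when `r = 0`, from the stronger bound on `a`
together with `k ≥ 2`. The remaining fields evaluate the threshold for quotients up to 4. -/
lemma parameters_of_threshold {q r : ℤ} (hk : 2 ≤ k) (hN : 2 * k + 2 ≤ N) (ha : 0 ≤ a)
    (total : N * (N + 1) = 2 * k * (R + a)) (hqr : N = k * q + r) (hr : 0 ≤ r) (_ : r < k)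
    (h : a ≤ 2 * q - 1) (h0 : r = 0 → a ≤ 2 * q - 2) : Parameters k N a R where
  two_le := hk
  le := hN
  nonneg := ha
  total := total
  mul_le := by
    rcases hr.eq_or_lt with h1 | h1
    · have := h0 h1.symm; nlinarith
    · nlinarith
  le_three h3 := by
    have : q < 3 := by
      by_contra h4
      nlinarith
    omega
  le_four h3 := by
    have : q ≤ 3 := by
      by_contra h4
      nlinarith
    by_cases h5 : q = 3
    · have := h0 (by subst h5; linarith)
      omega
    · omega
  le_five h3 := by
    have : q < 4 := by
      by_contra h4
      nlinarith
    omega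
  le_six h3 := by
    have : q ≤ 4 := by
      by_contra h4
      nlinarith
    by_cases h5 : q = 4
    · have := h0 (by subst h5; linarith)
      omega
    · omega

/-- Divisibility restricts the values of `k` when `N` is slightly larger than a multiple of
`2 * k`. -/
lemma Parameters.mul_succ_eq (h : Parameters k N a R) {j s : ℤ} (hs : N = 2 * k * j + s) :
    ∃ t, s * (s + 1) = 2 * k * t :=
  ⟨R + a - 2 * k * j ^ 2 - 2 * j * s - j, by
    have := h.total
    subst hs
    linear_combination this⟩

lemma Parameters.cases_two (h : Parameters k N a R) (hN : N < 2 * k + 3) : k = 3 ∧ N = 8 := by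
  obtain ⟨t, ht⟩ := h.mul_succ_eq (j := 1) (s := 2) (by have := h.le; linarith)
  have h3 : k * t = 3 := by linarith
  have hk := h.two_le
  have hle := h.le
  have : k ≤ 3 := Int.le_of_dvd (by norm_num) ⟨t, h3.symm⟩
  obtain rfl | rfl : k = 2 ∨ k = 3 := by omega
  · omega
  · omega

/-- With `s = N - 4 * k`, the number `2 * k` divides `s * (s + 1)`, so `k` divides 1, 3 or 6. -/
lemma Parameters.cases_four (h : Parameters k N a R) (hN : 4 * k < N) (hN' : N < 4 * k + 4) :
    (k = 3 ∧ N = 14) ∨ (k = 3 ∧ N = 15) ∨ (k = 2 ∧ N = 11) ∨ (k = 6 ∧ N = 27) := by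
  obtain ⟨t, ht⟩ := h.mul_succ_eq (j := 2) (s := N - 4 * k) (by ring)
  have hk := h.two_le
  obtain h1 | h1 | h1 : N - 4 * k = 1 ∨ N - 4 * k = 2 ∨ N - 4 * k = 3 := by omega
  · rw [h1] at ht
    have h3 : k * t = 1 := by linarith
    have : k ≤ 1 := Int.le_of_dvd (by norm_num) ⟨t, h3.symm⟩
    omega
  · rw [h1] at ht
    have h3 : k * t = 3 := by linarith
    have : k ≤ 3 := Int.le_of_dvd (by norm_num) ⟨t, h3.symm⟩
    obtain rfl | rfl : k = 2 ∨ k = 3 := by omega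
    · omega
    · omega
  · rw [h1] at ht
    have h3 : k * t = 6 := by linarith
    have : k ≤ 6 := Int.le_of_dvd (by norm_num) ⟨t, h3.symm⟩
    obtain rfl | rfl | rfl | rfl | rfl : k = 2 ∨ k = 3 ∨ k = 4 ∨ k = 5 ∨ k = 6 := by omega
    all_goals omega

/-- Level 2 leaves an excess well within the capacity but needs two stars per vertex. If there are
fewer, then `N < 4 * k + 4`, and level 1 fits. -/
lemma exists_level_zero (h : Parameters k N a R)
    (hQ : (N + 1) * (N + 3 - 2 * k) - 4 * (k * a) ≤ 2 * (k * Q)) :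
    ∃ l, 0 ≤ l ∧ 0 ≤ R - l * (N + 1) ∧ R - l * (N + 1) ≤ Q := by
  have hk := h.two_le
  have hN := h.le
  have ht := h.total
  have hka := h.mul_le
  by_cases h8 : N < 2 * k + 3
  · obtain ⟨rfl, rfl⟩ := h.cases_two h8
    have := h.le_three (by norm_num)
    have := h.nonneg
    exact ⟨1, by omega⟩
  by_cases h2 : 2 * (N + 1) ≤ R
  · refine ⟨2, by norm_num, by linarith, ?_⟩
    by_contra hlt
    have h3 : 2 * k * (Q + 1) ≤ 2 * k * (R - 2 * (N + 1)) :=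
      mul_le_mul_of_nonneg_left (by linarith) (by linarith)
    nlinarith
  · have h1 : N + 1 ≤ R := by
      by_contra hlt
      have h3 : 2 * k * (R + 1) ≤ 2 * k * (N + 1) :=
        mul_le_mul_of_nonneg_left (by linarith) (by linarith)
      nlinarith
    refine ⟨1, by norm_num, by linarith, ?_⟩
    by_contra hlt
    have h3 : 2 * k * (Q + 1) ≤ 2 * k * (R - 1 * (N + 1)) :=
      mul_le_mul_of_nonneg_left (by linarith) (by linarith)
    have h4 : 2 * k * R ≤ 2 * k * (2 * (N + 1)) :=
      mul_le_mul_of_nonneg_left (by linarith) (by linarith)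
    have h5 : 4 * k + 6 < N := by nlinarith
    nlinarith

/-- The number `ρ` of edges at the exceptional vertex that its own stars leave over adds to the load
of the others. `hQ` bounds the capacity through rounding losses and `hQ'` through the number of
vertices of capacity 0; near `N = 4 * k` the first alone is too weak. -/
lemma exists_level_one (h : Parameters k N a R) (hc : k * c = N - D - ρ) (hρ : 0 ≤ ρ)
    (hρk : ρ ≤ k - 1) (hD : N + 3 ≤ 2 * D) (hDa : D ≤ k * a)
    (hQ : N * (N + 2 - 2 * k) - 2 * (2 * (k * a) - D) ≤ 2 * (k * Q))
    (hQ' : (N + 2 - 2 * k) * (N - Q) ≤ 2 * (2 * (k * a) - D)) :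
    ∃ l, 0 ≤ l ∧ 0 ≤ R - c - l * N ∧ R - c - l * N ≤ Q := by
  have hk := h.two_le
  have hN := h.le
  have ht := h.total
  have hka := h.mul_le
  by_cases h8 : N < 2 * k + 3
  · obtain ⟨rfl, rfl⟩ := h.cases_two h8
    have := h.le_three (by norm_num)
    have := h.nonneg
    exact ⟨1, by omega⟩
  by_cases h2 : 2 * N ≤ R - c
  · refine ⟨2, by norm_num, by linarith, ?_⟩
    by_contra hlt
    have h3 : 2 * k * (Q + 1) ≤ 2 * k * (R - c - 2 * N) :=
      mul_le_mul_of_nonneg_left (by linarith) (by linarith)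
    nlinarith
  have h4 : 2 * k * (R - c) ≤ 2 * k * (2 * N) :=
    mul_le_mul_of_nonneg_left (by linarith) (by linarith)
  have h1 : N ≤ R - c := by
    by_contra hlt
    have h3 : 2 * k * (R - c + 1) ≤ 2 * k * N :=
      mul_le_mul_of_nonneg_left (by linarith) (by linarith)
    nlinarith
  refine ⟨1, by norm_num, by linarith, ?_⟩
  by_contra hlt
  have h3 : 2 * k * (Q + 1) ≤ 2 * k * (R - c - 1 * N) :=
    mul_le_mul_of_nonneg_left (by linarith) (by linarith)
  -- If level 1 fails, `hQ` forces both the number of stars and the remainder to be nearly as large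
  -- as possible.
  have h5 : 3 * N - 1 + 2 * k < 2 * (k * a) + 2 * ρ := by nlinarith
  rcases lt_trichotomy N (4 * k) with h6 | h6 | h6
  · have ha5 := h.le_five h6
    have h7 : a = 5 := by
      by_contra h7
      have : k * a ≤ k * 4 := mul_le_mul_of_nonneg_left (by omega) (by omega)
      have : 3 * k < N := by
        by_contra h8
        rcases (not_lt.1 h8).lt_or_eq with h8 | h8
        · have : k * a ≤ k * 3 := mul_le_mul_of_nonneg_left (h.le_three h8) (by omega)
          linarith
        · linarith
      linarith
    subst h7
    have h3k : 3 * k < N := by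
      by_contra h8
      rcases (not_lt.1 h8).lt_or_eq with h8 | h8
      · have := h.le_three h8; omega
      · have := h.le_four h8; omega
    obtain ⟨p, hp, hp'⟩ : ∃ p, 0 ≤ p ∧ N = 3 * k + (1 + p) := ⟨N - 3 * k - 1, by omega, by omega⟩
    -- The lower bound on `k` comes from `h5` with `a = 5`. In terms of `p` and `t` the
    -- contradiction is the positivity of a polynomial with positive coefficients.
    obtain ⟨t, ht0, ht'⟩ : ∃ t, 0 ≤ t ∧ k = 3 * (1 + p) + 2 + t :=
      ⟨k - 3 * (1 + p) - 2, by omega, by omega⟩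
    have e1 : (N + 2 - 2 * k) * (N + 1 - (R - c - 1 * N)) ≤ 2 * (2 * (k * 5) - D) :=
      (mul_le_mul_of_nonneg_left (by linarith) (by linarith)).trans hQ'
    have e2 : (N + 2 - 2 * k) * (2 * k * (N + 1 - (R - c - 1 * N))) ≤
        2 * k * (2 * (2 * (k * 5) - D)) := by
      have := mul_le_mul_of_nonneg_left e1 (by linarith : 0 ≤ 2 * k)
      linarith
    have e3 : 2 * k * (N + 1 - (R - c - 1 * N)) =
        4 * k * N + 2 * k - N ^ 2 + N + 10 * k - 2 * D - 2 * ρ := by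
      linear_combination ht + 2 * hc
    rw [e3] at e2
    have e4 : 0 ≤ (8 * k - 2 * N - 4) * (2 * D - (N + 3)) :=
      mul_nonneg (by linarith) (by linarith)
    have e5 : 0 ≤ (N + 2 - 2 * k) * (k - 1 - ρ) := mul_nonneg (by linarith) (by linarith)
    have e6 : 0 < 94 + 282 * p + 180 * p * t + 28 * p * t ^ 2 + 268 * p ^ 2 + 84 * p ^ 2 * t +
      80 * p ^ 3 + 85 * t + 28 * t ^ 2 + 3 * t ^ 3 := by positivity
    subst ht' hp'
    linarith
  · have : k * a ≤ k * 6 := mul_le_mul_of_nonneg_left (h.le_six h6) (by omega)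
    linarith
  · have h7 : N < 4 * k + 4 := by
      by_contra h7
      nlinarith
    obtain ⟨rfl, rfl⟩ | ⟨rfl, rfl⟩ | ⟨rfl, rfl⟩ | ⟨rfl, rfl⟩ := h.cases_four h6 h7 <;> omega

set_option maxHeartbeats 400000 in
lemma exists_level_two (h : Parameters k N a R) (hc : k * c = 2 * N - D - ρ) (hρ : 0 ≤ ρ)
    (hρk : ρ ≤ 2 * k - 2) (hρN : N = 4 * k - 1 → ρ ≤ 2 * k - 3) (hD : N + 3 ≤ D)
    (hDa : D ≤ k * a + 1)
    (hQ : (N - 1) * (N + 1 - 2 * k) - 2 * (2 * (k * a) - D) ≤ 2 * (k * Q))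
    (hQe : N = 4 * k → (N - 1) * (N + 2 - 2 * k) - 2 * (2 * (k * a) - D) ≤ 2 * (k * Q))
    (hQ' : (N + 1 - 2 * k) * (N - 1 - Q) ≤ 2 * (2 * (k * a) - D)) :
    ∃ l, 0 ≤ l ∧ 0 ≤ R - c - l * (N - 1) ∧ R - c - l * (N - 1) ≤ Q := by
  have hk := h.two_le
  have hN := h.le
  have ht := h.total
  have hka := h.mul_le
  by_cases h8 : N < 2 * k + 3
  · obtain ⟨rfl, rfl⟩ := h.cases_two h8
    have := h.le_three (by norm_num)
    omega
  by_cases h2 : 2 * (N - 1) ≤ R - c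
  · refine ⟨2, by norm_num, by linarith, ?_⟩
    by_contra hlt
    have h3 : 2 * k * (Q + 1) ≤ 2 * k * (R - c - 2 * (N - 1)) :=
      mul_le_mul_of_nonneg_left (by linarith) (by linarith)
    nlinarith
  have h4 : 2 * k * (R - c) ≤ 2 * k * (2 * (N - 1)) :=
    mul_le_mul_of_nonneg_left (by linarith) (by linarith)
  have h1 : N - 1 ≤ R - c := by
    by_contra hlt
    have h3 : 2 * k * (R - c + 1) ≤ 2 * k * (N - 1) :=
      mul_le_mul_of_nonneg_left (by linarith) (by linarith)
    nlinarith
  refine ⟨1, by norm_num, by linarith, ?_⟩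
  by_contra hlt
  have h3 : 2 * k * (Q + 1) ≤ 2 * k * (R - c - 1 * (N - 1)) :=
    mul_le_mul_of_nonneg_left (by linarith) (by linarith)
  have h5 : 3 * N - 2 + 2 * k < 2 * (k * a) + 2 * ρ := by nlinarith
  have e1 : (N + 1 - 2 * k) * (N - (R - c - 1 * (N - 1))) ≤ 2 * (2 * (k * a) - D) :=
    (mul_le_mul_of_nonneg_left (by linarith) (by linarith)).trans hQ'
  have e2 : (N + 1 - 2 * k) * (2 * k * (N - (R - c - 1 * (N - 1)))) ≤
      2 * k * (2 * (2 * (k * a) - D)) := by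
    have := mul_le_mul_of_nonneg_left e1 (by linarith : 0 ≤ 2 * k)
    linarith
  have e3 : 2 * k * (N - (R - c - 1 * (N - 1))) =
      4 * k * N - 2 * k - N ^ 2 + 3 * N + 2 * k * a - 2 * D - 2 * ρ := by
    linear_combination ht + 2 * hc
  rw [e3] at e2
  have e5 : 0 ≤ (N + 1 - 2 * k) * (2 * k - 2 - ρ) := mul_nonneg (by linarith) (by linarith)
  rcases lt_trichotomy N (4 * k) with h6 | h6 | h6
  · have e4 : 0 ≤ (8 * k - 2 * N - 2) * (D - (N + 3)) := mul_nonneg (by linarith) (by linarith)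
    rcases lt_trichotomy N (3 * k) with h7 | h7 | h7
    · have ha : a = 3 := by
        by_contra ha
        have := h.le_three h7
        have : k * a ≤ k * 2 := mul_le_mul_of_nonneg_left (by omega) (by omega)
        linarith
      subst ha
      obtain ⟨p, hp, hp'⟩ : ∃ p, 0 ≤ p ∧ N = 2 * k + (3 + p) :=
        ⟨N - 2 * k - 3, by omega, by omega⟩
      obtain ⟨t, ht0, ht'⟩ : ∃ t, 0 ≤ t ∧ k = 3 + p + 1 + t := ⟨k - 4 - p, by omega, by omega⟩
      have e6 : 0 < 96 + 92 * p + 38 * p * t + 4 * p * t ^ 2 + 29 * p ^ 2 + 8 * p ^ 2 * t +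
        3 * p ^ 3 + 32 * t := by positivity
      subst ht' hp'
      linarith
    · have ha : a = 4 := by
        by_contra ha
        have := h.le_four h7
        have : k * a ≤ k * 3 := mul_le_mul_of_nonneg_left (by omega) (by omega)
        linarith
      subst ha h7
      obtain ⟨t, ht0, ht'⟩ : ∃ t, 0 ≤ t ∧ k = 2 + t := ⟨k - 2, by omega, by omega⟩
      have e6 : 0 < 4 + 3 * t + 6 * t ^ 2 + 3 * t ^ 3 := by positivity
      subst ht'
      linarith
    · have ha := h.le_five h6
      obtain ⟨x, hx⟩ := h.mul_succ_eq (j := 2) (s := N - 4 * k) (by ring)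
      -- Divisibility excludes `4 * k - 2` and `4 * k - 3`. It says nothing about `4 * k - 1`, where
      -- the sharper bound `hρN` is needed.
      have hy : N ≤ 4 * k - 4 := by
        by_contra hy
        obtain hy | hy | hy : N = 4 * k - 1 ∨ N = 4 * k - 2 ∨ N = 4 * k - 3 := by omega
        · have := hρN hy
          have : k * a ≤ k * 5 := mul_le_mul_of_nonneg_left ha (by omega)
          linarith
        · subst hy
          have h3 : k * x = 1 := by linarith
          have : k ≤ 1 := Int.le_of_dvd (by norm_num) ⟨x, h3.symm⟩
          omega
        · subst hy
          have h3 : k * x = 3 := by linarith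
          have : k ≤ 3 := Int.le_of_dvd (by norm_num) ⟨x, h3.symm⟩
          omega
      obtain ⟨p, hp, hp'⟩ : ∃ p, 0 ≤ p ∧ N = 4 * k - (4 + p) :=
        ⟨4 * k - 4 - N, by omega, by omega⟩
      obtain ⟨t, ht0, ht'⟩ : ∃ t, 0 ≤ t ∧ k = 4 + p + 1 + t := ⟨k - 5 - p, by omega, by omega⟩
      have e6 : 0 < 66 + 79 * p + 70 * p * t + 8 * p * t ^ 2 + 28 * p ^ 2 + 10 * p ^ 2 * t +
        3 * p ^ 3 + 120 * t + 24 * t ^ 2 := by positivity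
      have e7 : 0 ≤ 2 * k * ((6 * k - N - 1) * (5 - a)) :=
        mul_nonneg (by linarith) (mul_nonneg (by linarith) (by linarith))
      subst ht' hp'
      linarith
  · have : k * a ≤ k * 6 := mul_le_mul_of_nonneg_left (h.le_six h6) (by omega)
    -- Here the ordinary rounding bound does not suffice; the parity of the degrees gains one unit
    -- per vertex.
    have hQe' := hQe h6
    linarith
  · have h7 : N < 4 * k + 4 := by
      by_contra h7
      have h9 : 0 ≤ N * (N - 4 * k - 4) := mul_nonneg (by linarith) (by linarith)
      have h10 : 6 * k + 10 ≤ N := by linarith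
      have h11 : 0 ≤ N * (N - 4 * k - 5) := mul_nonneg (by linarith) (by linarith)
      linarith
    obtain ⟨rfl, rfl⟩ | ⟨rfl, rfl⟩ | ⟨rfl, rfl⟩ | ⟨rfl, rfl⟩ := h.cases_four h6 h7 <;> omega

set_option maxHeartbeats 400000 in
lemma exists_level_three (h : Parameters k N a R) (hc : k * c = 3 * N - D - ρ) (hρ : 0 ≤ ρ)
    (hρk : ρ ≤ 3 * k) (hD : 3 * N + 7 ≤ 2 * D) (hDa : D ≤ k * a + 3)
    (hQ : (N - 2) * (N - 2 * k) - 2 * (2 * (k * a) - D) ≤ 2 * (k * Q))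
    (hQ' : (N - 2 * k) * (N - 2 - Q) ≤ 2 * (2 * (k * a) - D)) :
    ∃ l, 0 ≤ l ∧ 0 ≤ R - c - l * (N - 2) ∧ R - c - l * (N - 2) ≤ Q := by
  have hk := h.two_le
  have hN := h.le
  have ht := h.total
  have hka := h.mul_le
  by_cases h8 : N < 2 * k + 3
  · obtain ⟨rfl, rfl⟩ := h.cases_two h8
    have := h.le_three (by norm_num)
    omega
  by_cases h2 : 2 * (N - 2) ≤ R - c
  · refine ⟨2, by norm_num, by linarith, ?_⟩
    by_contra hlt
    have h3 : 2 * k * (Q + 1) ≤ 2 * k * (R - c - 2 * (N - 2)) :=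
      mul_le_mul_of_nonneg_left (by linarith) (by linarith)
    nlinarith
  have h4 : 2 * k * (R - c) ≤ 2 * k * (2 * (N - 2)) :=
    mul_le_mul_of_nonneg_left (by linarith) (by linarith)
  have h1 : N - 2 ≤ R - c := by
    by_contra hlt
    have h3 : 2 * k * (R - c + 1) ≤ 2 * k * (N - 2) :=
      mul_le_mul_of_nonneg_left (by linarith) (by linarith)
    nlinarith
  refine ⟨1, by norm_num, by linarith, ?_⟩
  by_contra hlt
  have h3 : 2 * k * (Q + 1) ≤ 2 * k * (R - c - 1 * (N - 2)) :=
    mul_le_mul_of_nonneg_left (by linarith) (by linarith)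
  have h5 : 3 * N - 1 + 2 * k < 2 * (k * a) + 2 * ρ := by nlinarith
  rcases lt_trichotomy N (4 * k) with h6 | h6 | h6
  · have ha : a = 5 := by
      by_contra ha
      have := h.le_five h6
      rcases lt_trichotomy N (3 * k) with h7 | h7 | h7
      · have : k * a ≤ k * 3 := mul_le_mul_of_nonneg_left (h.le_three h7) (by omega)
        linarith
      · have : k * a ≤ k * 4 := mul_le_mul_of_nonneg_left (h.le_four h7) (by omega)
        linarith
      · have : k * a ≤ k * 4 := mul_le_mul_of_nonneg_left (by omega) (by omega)
        linarith
    have h7 : 3 * k < N := by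
      by_contra h7
      rcases (not_lt.1 h7).lt_or_eq with h8 | h8
      · have := h.le_three h8; omega
      · have := h.le_four h8; omega
    subst ha
    have e1 : (N - 2 * k) * (N - 1 - (R - c - 1 * (N - 2))) ≤ 2 * (2 * (k * 5) - D) :=
      (mul_le_mul_of_nonneg_left (by linarith) (by linarith)).trans hQ'
    have e2 : (N - 2 * k) * (2 * k * (N - 1 - (R - c - 1 * (N - 2)))) ≤
        2 * k * (2 * (2 * (k * 5) - D)) := by
      have := mul_le_mul_of_nonneg_left e1 (by linarith : 0 ≤ 2 * k)
      linarith
    have e3 : 2 * k * (N - 1 - (R - c - 1 * (N - 2))) =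
        4 * k * N + 4 * k - N ^ 2 + 5 * N - 2 * D - 2 * ρ := by
      linear_combination ht + 2 * hc
    rw [e3] at e2
    have e5 : 0 ≤ (N - 2 * k) * (3 * k - ρ) := mul_nonneg (by linarith) (by linarith)
    have e4 : 0 ≤ (8 * k - 2 * N) * (2 * D - (3 * N + 6)) :=
      mul_nonneg (by linarith) (by linarith)
    obtain ⟨p, hp, hp'⟩ : ∃ p, 0 ≤ p ∧ N = 3 * k + (1 + p) := ⟨N - 3 * k - 1, by omega, by omega⟩
    obtain ⟨t, ht0, ht'⟩ : ∃ t, 0 ≤ t ∧ k = 3 * (1 + p) + 1 + t :=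
      ⟨k - 3 * (1 + p) - 1, by omega, by omega⟩
    obtain ⟨x, hx⟩ := h.mul_succ_eq (j := 1) (s := N - 2 * k) (by ring)
    -- The corner `k = 4`, `N = 13` is excluded by divisibility.
    have hpt : 1 ≤ p + t := by
      by_contra hpt
      obtain ⟨rfl, rfl⟩ : p = 0 ∧ t = 0 := by omega
      subst ht' hp'
      omega
    have e6 : 0 ≤ 81 * p + 128 * p * t + 28 * p * t ^ 2 + 84 * p ^ 2 * t + 80 * p ^ 3 +
      3 * t ^ 3 := by positivity
    have e7 : 0 ≤ 2 * p ^ 2 := by positivity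
    have e8 : 2 < 198 * p ^ 2 + 19 * t ^ 2 := by
      linarith [Int.le_self_sq p, Int.le_self_sq t, sq_nonneg p]
    subst ht' hp'
    linarith
  · have : k * a ≤ k * 6 := mul_le_mul_of_nonneg_left (h.le_six h6) (by omega)
    linarith
  · have h7 : N < 4 * k + 4 := by
      by_contra h7
      have h9 : 0 ≤ N * (N - 4 * k - 4) := mul_nonneg (by linarith) (by linarith)
      have h10 : 10 * k + 11 ≤ 2 * N := by linarith
      have h11 : 0 ≤ N * (N - 4 * k - 6) := mul_nonneg (by linarith) (by linarith)
      linarith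
    obtain ⟨rfl, rfl⟩ | ⟨rfl, rfl⟩ | ⟨rfl, rfl⟩ | ⟨rfl, rfl⟩ := h.cases_four h6 h7 <;> omega

end Arithmetic

/-! ### Capacities and conditions on the exceptional set -/

section Choice

variable {V : Type*} [Fintype V] [DecidableEq V] {R : SimpleGraph V} [DecidableRel R.Adj]

lemma degree_compl_add (v : V) : Rᶜ.degree v + R.degree v + 1 = Fintype.card V := by
  have h1 := R.degree_compl v
  have h2 := R.degree_lt_card_verts v
  omega

lemma adjCount_compl_univ :
    adjCount Rᶜ univ univ =
      Fintype.card V * ((Fintype.card V : ℤ) - 1) - ∑ v, (R.degree v : ℤ) := by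
  rw [adjCount_univ_right, eq_sub_iff_add_eq, ← sum_add_distrib, ← nsmul_eq_mul, ← card_univ,
    ← sum_const]
  refine sum_congr rfl fun v _ => ?_
  have := degree_compl_add (R := R) v
  rw [card_univ]
  push_cast [← this]
  ring

/-- Summing degrees over `H` counts only the edges inside `H` twice, and there are at most `#H * (#H
- 1) / 2` of these. -/
lemma two_mul_sum_degree_le (H : Finset V) :
    2 * ∑ v ∈ H, (R.degree v : ℤ) ≤ ∑ v, (R.degree v : ℤ) + #H * (#H - 1) := by
  have h1 := adjCount_self_le R H
  have hd : Disjoint H Hᶜ := disjoint_compl_right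
  have h2 : adjCount R H univ = adjCount R H H + adjCount R H Hᶜ := by
    rw [← adjCount_union_right R hd, union_compl]
  have h3 : adjCount R univ univ = adjCount R H univ + adjCount R Hᶜ univ := by
    rw [← adjCount_union_left R hd, union_compl]
  have h4 : adjCount R Hᶜ univ = adjCount R H Hᶜ + adjCount R Hᶜ Hᶜ := by
    rw [adjCount_comm R H, ← adjCount_union_right R hd, union_compl]
  have h5 := adjCount_nonneg R Hᶜ Hᶜ
  rw [← adjCount_univ_right, ← adjCount_univ_right]
  linarith

lemma exists_le_sum_eq {ι : Type*} (s : Finset ι) (f : ι → ℕ) (w : ℕ) (h : w ≤ ∑ i ∈ s, f i) :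
    ∃ g : ι → ℕ, (∀ i, g i ≤ f i) ∧ ∑ i ∈ s, g i = w := by
  classical
  induction s using Finset.induction_on generalizing w with
  | empty => exact ⟨0, fun _ => Nat.zero_le _, by simp at h ⊢; omega⟩
  | insert i s hi ih =>
    rw [sum_insert hi] at h
    obtain ⟨g, hg, hgs⟩ := ih (w - min w (f i)) (by omega)
    refine ⟨Function.update g i (min w (f i)), fun j => ?_, ?_⟩
    · by_cases hj : j = i
      · subst hj; simp
      · simpa [hj] using hg j
    · rw [sum_insert hi, Function.update_self, sum_congr rfl fun j hj => by
        rw [Function.update_of_ne (ne_of_mem_of_not_mem hj hi)], hgs]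
      omega

variable (R) in
/-- How many stars a vertex outside of the exceptional set `H` may have in excess of the common
level. -/
def capacity (k : ℕ) (H : Finset V) (v : V) : ℕ :=
  (Fintype.card V + 1 - #H - 2 * R.degree v) / (2 * k)

/-- `capacity` is the largest excess over `l` that the degree condition of `isCentral_of_level`
permits. The stars not used by `c` on `H` and by the level elsewhere can therefore be distributed
greedily outside `H`. -/
theorem exists_isCentral_of_capacity {k : ℕ} {H : Finset V} {c : V → ℕ} {M l : ℤ}
    (total : adjCount Rᶜ univ univ = 2 * (k : ℤ) * M)
    (lower : ∀ X ⊆ H, adjCount Rᶜ X X ≤ ∑ v ∈ X, 2 * (k : ℤ) * c v)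
    (upper : ∀ X ⊆ H, (∑ v ∈ X, 2 * (k : ℤ) * c v) + adjCount Rᶜ X X ≤ 2 * adjCount Rᶜ X univ)
    (light : ∀ v ∉ H, 2 * R.degree v + #H ≤ Fintype.card V + 1)
    (hl : 0 ≤ l) (h0 : 0 ≤ M - (∑ v ∈ H, c v : ℕ) - l * (Fintype.card V - #H))
    (hQ : M - (∑ v ∈ H, c v : ℕ) - l * (Fintype.card V - #H) ≤ (∑ v ∈ Hᶜ, capacity R k H v : ℕ)) :
    ∃ c : V → ℕ, IsCentral Rᶜ k c := by
  obtain ⟨l, rfl⟩ := Int.eq_ofNat_of_zero_le hl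
  obtain ⟨w, hw⟩ := Int.eq_ofNat_of_zero_le h0
  rw [hw] at hQ
  obtain ⟨g, hg, hgw⟩ := exists_le_sum_eq Hᶜ (capacity R k H) w (by exact_mod_cast hQ)
  have hin : ∀ v ∈ H, (if v ∈ H then c v else l + g v) = c v := fun v hv => if_pos hv
  have hout : ∀ v ∉ H, (if v ∈ H then c v else l + g v) = l + g v := fun v hv => if_neg hv
  have hsub : ∀ X ⊆ H, ∑ v ∈ X, 2 * (k : ℤ) * ((if v ∈ H then c v else l + g v : ℕ) : ℤ) =
      ∑ v ∈ X, 2 * (k : ℤ) * c v := fun X hX =>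
    sum_congr rfl fun v hv => by rw [hin v (hX hv)]
  refine ⟨fun v => if v ∈ H then c v else l + g v, isCentral_of_level H l ?_ ?_ ?_ ?_ ?_⟩
  · rw [total, ← mul_sum, ← Nat.cast_sum, ← sum_add_sum_compl H, sum_congr rfl hin,
      sum_congr rfl fun v hv => hout v (mem_compl.1 hv), sum_add_distrib, hgw, sum_const,
      smul_eq_mul, card_compl]
    have := card_le_univ H
    push_cast [Nat.cast_sub this] at hw ⊢
    congr 1
    linarith
  · intro X hX
    rw [hsub X hX]
    exact lower X hX
  · intro X hX
    rw [hsub X hX]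
    exact upper X hX
  · intro v hv
    rw [hout v hv]
    exact Nat.le_add_right _ _
  · intro v hv
    rw [hout v hv]
    have h1 := light v hv
    have h2 : 2 * k * g v ≤ Fintype.card V + 1 - #H - 2 * R.degree v :=
      (Nat.mul_le_mul_left _ (hg v)).trans (Nat.mul_div_le _ _)
    have h3 := degree_compl_add (R := R) v
    zify at h3
    have h4 : (2 * k * g v : ℤ) + 2 * R.degree v + #H ≤ Fintype.card V + 1 := by
      have : 2 * k * g v + 2 * R.degree v + #H ≤ Fintype.card V + 1 := by omega
      exact_mod_cast this
    push_cast
    linarith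

section CapacityBounds

variable {k : ℕ} {H : Finset V}

lemma card_compl_cast : (#Hᶜ : ℤ) = Fintype.card V - #H := by
  rw [card_compl, Nat.cast_sub (card_le_univ H)]

variable (light : ∀ v ∉ H, 2 * R.degree v + #H ≤ Fintype.card V + 1)

include light in
-- Rounding down loses at most `2 * k - 1` in each numerator.
lemma le_capacity_sum (hk : 0 < k) :
    ((Fintype.card V : ℤ) - #H) * (Fintype.card V + 2 - #H - 2 * k) -
      2 * ∑ v ∈ Hᶜ, (R.degree v : ℤ) ≤ 2 * (k * (∑ v ∈ Hᶜ, capacity R k H v : ℕ)) := by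
  rw [← card_compl_cast, ← nsmul_eq_mul, ← sum_const, mul_sum, ← sum_sub_distrib, Nat.cast_sum,
    mul_sum, mul_sum]
  refine sum_le_sum fun v hv => ?_
  have h1 := light v (mem_compl.1 hv)
  have h2 := Nat.div_add_mod (Fintype.card V + 1 - #H - 2 * R.degree v) (2 * k)
  have h3 := Nat.mod_lt (Fintype.card V + 1 - #H - 2 * R.degree v) (show 2 * k > 0 by omega)
  rw [← capacity] at h2
  rw [← mul_assoc]
  have h4 : Fintype.card V + 2 ≤
      2 * k * capacity R k H v + 2 * k + #H + 2 * R.degree v := by omega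
  zify at h4
  linarith

include light in
-- All numerators are even, so rounding down loses at most `2 * k - 2`.
lemma le_capacity_sum_of_even (hk : 0 < k) (he : Even (Fintype.card V + 1 + #H)) :
    ((Fintype.card V : ℤ) - #H) * (Fintype.card V + 3 - #H - 2 * k) -
      2 * ∑ v ∈ Hᶜ, (R.degree v : ℤ) ≤ 2 * (k * (∑ v ∈ Hᶜ, capacity R k H v : ℕ)) := by
  rw [← card_compl_cast, ← nsmul_eq_mul, ← sum_const, mul_sum, ← sum_sub_distrib, Nat.cast_sum,
    mul_sum, mul_sum]
  refine sum_le_sum fun v hv => ?_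
  have h1 := light v (mem_compl.1 hv)
  obtain ⟨e, he⟩ := he
  have h2 := Nat.div_add_mod (Fintype.card V + 1 - #H - 2 * R.degree v) (2 * k)
  have h3 := Nat.mod_lt (Fintype.card V + 1 - #H - 2 * R.degree v) (show 2 * k > 0 by omega)
  rw [← capacity] at h2
  rw [← mul_assoc]
  have h4 : Fintype.card V + 3 ≤
      2 * k * capacity R k H v + 2 * k + #H + 2 * R.degree v := by
    rw [mul_assoc] at h2 ⊢
    omega
  zify at h4
  linarith

include light in
-- A vertex of capacity 0 has large degree in `R`, and the degree sum limits how many there are.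
lemma mul_sub_capacity_sum_le (hk : 0 < k) (hn : 2 * k + #H ≤ Fintype.card V + 2) :
    ((Fintype.card V : ℤ) + 2 - #H - 2 * k) *
        (Fintype.card V - #H - (∑ v ∈ Hᶜ, capacity R k H v : ℕ)) ≤
      2 * ∑ v ∈ Hᶜ, (R.degree v : ℤ) := by
  rw [← card_compl_cast, card_eq_sum_ones Hᶜ, Nat.cast_sum, Nat.cast_sum, ← sum_sub_distrib, mul_sum,
    mul_sum]
  refine sum_le_sum fun v hv => ?_
  have h1 := light v (mem_compl.1 hv)
  zify at hn
  rcases Nat.eq_zero_or_pos (capacity R k H v) with h2 | h2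
  · rw [h2]
    rw [capacity, Nat.div_eq_zero_iff] at h2
    have h3 : Fintype.card V + 2 ≤ 2 * k + #H + 2 * R.degree v := by omega
    zify at h3
    push_cast
    linarith
  · have h3 : (1 : ℤ) ≤ capacity R k H v := by exact_mod_cast h2
    have h4 : (0 : ℤ) ≤ R.degree v := Int.natCast_nonneg _
    push_cast
    nlinarith

end CapacityBounds

section Exceptional

omit [Fintype V] [DecidableEq V] in
lemma adjCount_self_le_of_pair {G : SimpleGraph V} {X : Finset V} {x y : V}
    (h : ∀ u ∈ X, ∀ v ∈ X, G.Adj u v → s(u, v) = s(x, y)) :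
    adjCount G X X ≤ 2 ∧ (adjCount G X X ≠ 0 → x ∈ X ∧ y ∈ X ∧ G.Adj x y) := by
  classical
  have hcard : adjCount G X X = #{p ∈ X ×ˢ X | G.Adj p.1 p.2} := by
    rw [adjCount, card_filter, sum_product]
    push_cast
    rfl
  rw [hcard]
  constructor
  · have h1 : {p ∈ X ×ˢ X | G.Adj p.1 p.2} ⊆ {(x, y), (y, x)} := fun p hp => by
      simp only [mem_filter, mem_product] at hp
      have := h _ hp.1.1 _ hp.1.2 hp.2
      rw [Sym2.eq_iff] at this
      simpa [Prod.ext_iff] using this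
    exact_mod_cast (card_le_card h1).trans card_le_two
  · intro h0
    obtain ⟨p, hp⟩ := card_ne_zero.1 (by exact_mod_cast h0 : #{p ∈ X ×ˢ X | G.Adj p.1 p.2} ≠ 0)
    simp only [mem_filter, mem_product] at hp
    have := h _ hp.1.1 _ hp.1.2 hp.2
    rw [Sym2.eq_iff] at this
    rcases this with ⟨rfl, rfl⟩ | ⟨rfl, rfl⟩
    · exact ⟨hp.1.1, hp.1.2, hp.2⟩
    · exact ⟨hp.1.2, hp.1.1, hp.2.symm⟩

variable {k : ℕ} {H : Finset V} {c : V → ℕ} {G : SimpleGraph V} [DecidableRel G.Adj]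

/-- The edge `xy`, if present, is the only one inside `H`. One of its ends must receive it, hence `1
≤ c x + c y`; both degrees count it, hence the `+ 1`. -/
lemma bounds_of_pair {x y : V} (hk : 0 < k)
    (hadj : ∀ u ∈ H, ∀ v ∈ H, G.Adj u v → s(u, v) = s(x, y))
    (hc : ∀ v ∈ H, k * c v ≤ G.degree v)
    (hxy : G.Adj x y → 1 ≤ c x + c y ∧ k * (c x + c y) + 1 ≤ G.degree x + G.degree y) :
    (∀ X ⊆ H, adjCount G X X ≤ ∑ v ∈ X, 2 * (k : ℤ) * c v) ∧
    ∀ X ⊆ H, (∑ v ∈ X, 2 * (k : ℤ) * c v) + adjCount G X X ≤ 2 * adjCount G X univ := by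
  have key : ∀ X ⊆ H, adjCount G X X = 0 ∨ adjCount G X X ≤ 2 ∧ {x, y} ⊆ X ∧ G.Adj x y := by
    intro X hX
    have h1 := adjCount_self_le_of_pair fun u hu v hv => hadj u (hX hu) v (hX hv)
    by_cases h0 : adjCount G X X = 0
    · exact Or.inl h0
    · obtain ⟨hx, hy, h⟩ := h1.2 h0
      exact Or.inr ⟨h1.1, by simp [insert_subset_iff, hx, hy], h⟩
  constructor
  · intro X hX
    rcases key X hX with h | ⟨h, hX', hG⟩
    · rw [h]; positivity
    · refine h.trans (le_trans ?_ (sum_le_sum_of_subset_of_nonneg hX' fun _ _ _ => by positivity))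
      rw [sum_pair hG.ne]
      have h1 : 1 ≤ k * (c x + c y) := Nat.mul_pos hk (hxy hG).1
      zify at h1
      linarith
  · intro X hX
    have hle : ∀ v ∈ X, 2 * (k : ℤ) * c v ≤ 2 * G.degree v := fun v hv => by
      have := hc v (hX hv)
      zify at this
      linarith
    rw [adjCount_univ_right, mul_sum]
    rcases key X hX with h | ⟨h, hX', hG⟩
    · rw [h, add_zero]
      exact sum_le_sum hle
    · have h1 := sum_le_sum fun v (hv : v ∈ X \ {x, y}) => hle v (mem_sdiff.1 hv).1
      rw [← sum_sdiff hX', ← sum_sdiff hX', sum_pair hG.ne, sum_pair hG.ne]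
      have h2 := (hxy hG).2
      zify at h2
      linarith

/-- A vertex has at most two neighbours within `H`, so a reserve of one edge per vertex pays for all
edges inside `H`. For `lower`, `t ≤ 3` vertices give at most `t * (t - 1) ≤ 2 * k * (t - 1)` pairs.
-/
lemma bounds_of_card_le_three (hk : 2 ≤ k) (hH : #H ≤ 3)
    (hc : ∀ v ∈ H, k * c v ≤ G.degree v - 1)
    (z : V) (hz : ∀ v ∈ H, v ≠ z → 1 ≤ c v) :
    (∀ X ⊆ H, adjCount G X X ≤ ∑ v ∈ X, 2 * (k : ℤ) * c v) ∧
    ∀ X ⊆ H, (∑ v ∈ X, 2 * (k : ℤ) * c v) + adjCount G X X ≤ 2 * adjCount G X univ := by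
  constructor
  · intro X hX
    rcases X.eq_empty_or_nonempty with rfl | hne
    · simp [adjCount]
    have h1 := adjCount_self_le G X
    have h2 := card_le_card hX
    have h3 : #X - 1 ≤ #(X.erase z) := pred_card_le_card_erase
    have h4 : #(X.erase z) • (2 * (k : ℤ)) ≤ ∑ v ∈ X.erase z, 2 * (k : ℤ) * c v :=
      card_nsmul_le_sum _ _ _ fun v hv => by
        obtain ⟨hvz, hvX⟩ := mem_erase.1 hv
        have : (1 : ℤ) ≤ c v := by exact_mod_cast hz v (hX hvX) hvz
        nlinarith
    have h5 := sum_le_sum_of_subset_of_nonneg (erase_subset z X)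
      (f := fun v => 2 * (k : ℤ) * c v) fun _ _ _ => by positivity
    have h6 : 1 ≤ #X := hne.card_pos
    have h7 : (#X : ℤ) - 1 ≤ #(X.erase z) := by omega
    rw [nsmul_eq_mul] at h4
    have h8 : (2 : ℤ) ≤ k := by exact_mod_cast hk
    have h9 : (#X : ℤ) ≤ 3 := by exact_mod_cast h2.trans hH
    have h10 : (1 : ℤ) ≤ #X := by exact_mod_cast h6
    nlinarith [mul_nonneg (sub_nonneg.2 h10) (sub_nonneg.2 h9),
      mul_le_mul_of_nonneg_right h7 (show (0 : ℤ) ≤ 2 * k by positivity)]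
  · intro X hX
    rw [adjCount_univ_right, mul_sum, adjCount, ← sum_add_distrib]
    refine sum_le_sum fun v hv => ?_
    have h1 := hc v (hX hv)
    have h3 : #{u ∈ X | G.Adj v u} ≤ G.degree v := by
      rw [← G.card_neighborFinset_eq_degree]
      exact card_le_card fun u hu => by simpa using (mem_filter.1 hu).2
    have h4 : #{u ∈ X | G.Adj v u} + 1 ≤ #X := by
      refine card_lt_card (filter_ssubset.2 ⟨v, hv, G.irrefl⟩)
    have h5 := card_le_card hX
    have h6 : 2 * (k * c v) + #{u ∈ X | G.Adj v u} ≤ 2 * G.degree v := by omega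
    zify at h6
    refine le_trans (le_of_eq ?_) h6
    rw [← mul_assoc]
    congr 1
    push_cast [card_filter]
    exact sum_congr rfl fun u _ => by congr

end Exceptional

end Choice

/-! ### Choosing the central function -/

section Completion

variable {V : Type*} [Fintype V] [DecidableEq V] {R : SimpleGraph V} [DecidableRel R.Adj]
  {k a M : ℕ}

lemma adjCount_compl_eq (hR : ∑ v, R.degree v = 2 * (k * a))
    (hM : (Fintype.card V - 1 : ℤ) * Fintype.card V = 2 * k * (M + a)) :
    adjCount Rᶜ univ univ = 2 * (k : ℤ) * M := by
  zify at hR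
  rw [adjCount_compl_univ, hR]
  linarith

lemma sum_compl_degree (hR : ∑ v, R.degree v = 2 * (k * a)) (H : Finset V) :
    ∑ v ∈ Hᶜ, (R.degree v : ℤ) = 2 * (k * a) - ∑ v ∈ H, (R.degree v : ℤ) := by
  have := sum_add_sum_compl H fun v => (R.degree v : ℤ)
  zify at hR
  linarith

lemma sum_degree_le (hR : ∑ v, R.degree v = 2 * (k * a)) (H : Finset V) :
    2 * ∑ v ∈ H, (R.degree v : ℤ) ≤ 2 * (k * a) + #H * (#H - 1) := by
  have := two_mul_sum_degree_le (R := R) H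
  zify at hR
  rwa [hR] at this

/-- One star is centred at every vertex outside `H` and none in `H`; this needs `H` independent in
`Rᶜ`. -/
lemma exists_isCentral_of_card_add_eq (hR : ∑ v, R.degree v = 2 * (k * a))
    (hM : (Fintype.card V - 1 : ℤ) * Fintype.card V = 2 * k * (M + a)) {H : Finset V}
    (hH : #H + M = Fintype.card V) (hadj : ∀ u ∈ H, ∀ v ∈ H, ¬Rᶜ.Adj u v)
    (light : ∀ v ∉ H, 2 * R.degree v + #H ≤ Fintype.card V + 1) :
    ∃ c : V → ℕ, IsCentral Rᶜ k c := by
  have hzero : ∀ X ⊆ H, adjCount Rᶜ X X = 0 := fun X hX =>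
    sum_eq_zero fun u hu => sum_eq_zero fun v hv => if_neg (hadj u (hX hu) v (hX hv))
  zify at hH
  refine exists_isCentral_of_capacity (H := H) (c := fun _ => 0) (l := 1)
    (adjCount_compl_eq hR hM) (fun X hX => ?_) (fun X hX => ?_) light zero_le_one ?_ ?_
  · simp [hzero X hX]
  · simpa [hzero X hX] using adjCount_nonneg _ _ _
  · simp; linarith
  · simp only [sum_const_zero, Nat.cast_zero]
    have : (0 : ℤ) ≤ (∑ v ∈ Hᶜ, capacity R k H v : ℕ) := Int.natCast_nonneg _
    linarith

/-- At most two vertices are not centres of new stars: a vertex of maximum degree in `R` and, if a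
second is needed, one of its neighbours in `R`. -/
lemma exists_isCentral_of_card_le (hk : 2 ≤ k) (hR : ∑ v, R.degree v = 2 * (k * a))
    (hM : (Fintype.card V - 1 : ℤ) * Fintype.card V = 2 * k * (M + a))
    (h : Fintype.card V = 2 * k ∧ a ≤ 1 ∨ Fintype.card V = 2 * k + 1 ∧ a ≤ 2) :
    ∃ c : V → ℕ, IsCentral Rᶜ k c := by
  have : Nonempty V := Fintype.card_pos_iff.1 (by omega)
  obtain ⟨z, -, hz⟩ := exists_max_image univ (fun v => R.degree v) univ_nonempty
  have hpair : ∀ v, v ≠ z → 2 * R.degree v ≤ k * a + 1 := fun v hv => by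
    have h1 := sum_degree_le hR {v, z}
    rw [sum_pair hv, card_pair hv] at h1
    have h2 := hz v (mem_univ v)
    push_cast at h1
    zify at h2 ⊢
    linarith
  have hk' : (2 : ℤ) ≤ k := by exact_mod_cast hk
  have hMn : (Fintype.card V = 2 * k ∧ M + a + 1 = Fintype.card V) ∨
      (Fintype.card V = 2 * k + 1 ∧ M + a = Fintype.card V) := by
    rcases h with ⟨h, -⟩ | ⟨h, -⟩
    · refine Or.inl ⟨h, ?_⟩
      rw [h] at hM ⊢
      push_cast at hM
      zify
      have : (2 * k : ℤ) * (M + a + 1) = 2 * k * (2 * k) := by linarith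
      exact mul_left_cancel₀ (by positivity) this
    · refine Or.inr ⟨h, ?_⟩
      rw [h] at hM ⊢
      push_cast at hM
      zify
      have : (2 * k : ℤ) * (M + a) = 2 * k * (2 * k + 1) := by linarith
      exact mul_left_cancel₀ (by positivity) this
  have hcases : M = Fintype.card V ∧ a = 0 ∨
      M + 1 = Fintype.card V ∧ k * a + 1 ≤ Fintype.card V ∨
      M + 2 = Fintype.card V ∧ 1 ≤ a ∧ k * a + 1 ≤ Fintype.card V := by
    have ha : a = 0 ∨ a = 1 ∨ a = 2 := by omega
    rcases ha with rfl | rfl | rfl <;> omega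
  rcases hcases with ⟨h1, rfl⟩ | ⟨h1, h2⟩ | ⟨h1, h2, h3⟩
  · refine exists_isCentral_of_card_add_eq (H := ∅) hR hM (by simpa using h1) (by simp)
      fun v _ => ?_
    have := (sum_eq_zero_iff.1 (hR.trans (by simp))) v (mem_univ v)
    simp [this]
  · refine exists_isCentral_of_card_add_eq (H := {z}) hR hM
      (by rw [card_singleton]; omega) (by simp) fun v hv => ?_
    have := hpair v (by simpa using hv)
    rw [card_singleton]
    omega
  · have hpos : 0 < R.degree z := by
      rw [Nat.pos_iff_ne_zero]
      intro h0
      have h4 : ∑ v, R.degree v = 0 := sum_eq_zero fun v _ => by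
        have := hz v (mem_univ v)
        omega
      have : 0 < k * a := Nat.mul_pos (by omega) h2
      omega
    obtain ⟨y, hy⟩ := (R.degree_pos_iff_exists_adj z).1 hpos
    have hcard : #({z, y} : Finset V) = 2 := card_pair hy.ne
    refine exists_isCentral_of_card_add_eq (H := {z, y}) hR hM (by omega) ?_
      fun v hv => ?_
    · intro u hu v hv
      simp only [mem_insert, mem_singleton] at hu hv
      rcases hu with rfl | rfl <;> rcases hv with rfl | rfl <;> simp [hy, hy.symm]
    · have := hpair v fun h => hv (by simp [h])
      rw [hcard]
      rcases hMn with ⟨h4, h5⟩ | ⟨h4, h5⟩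
      · obtain rfl : a = 1 := by omega
        omega
      · obtain rfl : a = 2 := by omega
        omega

/-- Two non-adjacent vertices of degree five in a graph with ten edges on eight vertices. -/
lemma exists_isCentral_eight (hn : Fintype.card V = 8) {x y : V} (hR : ∑ v, R.degree v = 20)
    (hG : Rᶜ.Adj x y) (hx : R.degree x = 5) (hy : R.degree y = 5) :
    ∃ c : V → ℕ, IsCentral Rᶜ 2 c := by
  have hxy := hG.ne
  have hnadj : ¬R.Adj x y := ((SimpleGraph.compl_adj R x y).1 hG).2
  have hcompl : ∑ v ∈ ({x, y} : Finset V)ᶜ, R.degree v = 10 := by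
    have := sum_add_sum_compl {x, y} fun v => R.degree v
    rw [sum_pair hxy] at this
    omega
  have hcard : #({x, y} : Finset V)ᶜ = 6 := by rw [card_compl, card_pair hxy, hn]
  -- The five edges at `x` and the five at `y` are distinct, hence they are all ten edges.
  have hno : ∀ u ∈ ({x, y} : Finset V)ᶜ, ∀ v ∈ ({x, y} : Finset V)ᶜ, ¬R.Adj u v := by
    have hd : Disjoint ({x, y} : Finset V) {x, y}ᶜ := disjoint_compl_right
    have h1 : adjCount R {x, y} univ = 10 := by
      rw [adjCount_univ_right, sum_pair hxy, hx, hy]; norm_num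
    have h2 : adjCount R {x, y}ᶜ univ = 10 := by
      rw [adjCount_univ_right]; exact_mod_cast hcompl
    have h3 : adjCount R {x, y} {x, y} = 0 := by
      refine sum_eq_zero fun u hu => sum_eq_zero fun v hv => if_neg ?_
      simp only [mem_insert, mem_singleton] at hu hv
      rcases hu with rfl | rfl <;> rcases hv with rfl | rfl
      exacts [R.irrefl, hnadj, fun h => hnadj h.symm, R.irrefl]
    rw [← union_compl ({x, y} : Finset V), adjCount_union_right R hd] at h1 h2
    rw [adjCount_comm R {x, y}ᶜ {x, y}] at h2
    have h4 : adjCount R {x, y}ᶜ {x, y}ᶜ = 0 := by linarith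
    intro u hu v hv huv
    have h5 := (sum_eq_zero_iff_of_nonneg fun u _ => sum_nonneg fun v _ => by
      split <;> simp).1 h4 u hu
    have h6 := (sum_eq_zero_iff_of_nonneg fun v _ => by split <;> simp).1 h5 v hv
    simp [huv] at h6
  have hsub : ∀ v ∈ ({x, y} : Finset V)ᶜ, R.neighborFinset v ⊆ {x, y} := fun v hv u hu => by
    by_contra h
    exact hno v hv u (mem_compl.2 h) (by simpa using hu)
  have hle : ∀ v ∈ ({x, y} : Finset V)ᶜ, R.degree v ≤ 2 := fun v hv => by
    rw [← card_pair hxy, ← R.card_neighborFinset_eq_degree]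
    exact card_le_card (hsub v hv)
  obtain ⟨v, hv, hv2⟩ : ∃ v ∈ ({x, y} : Finset V)ᶜ, 2 ≤ R.degree v := by
    by_contra! h
    have := sum_le_card_nsmul _ _ 1 fun v hv => Nat.le_of_lt_succ (h v hv)
    rw [hcard, hcompl, smul_eq_mul] at this
    omega
  obtain ⟨u, hu, hu1⟩ : ∃ u ∈ ({x, y} : Finset V)ᶜ, R.degree u < 2 := by
    by_contra! h
    have := card_nsmul_le_sum _ _ 2 h
    rw [hcard, hcompl, smul_eq_mul] at this
    omega
  have hnb : R.neighborFinset v = {x, y} := eq_of_subset_of_card_le (hsub v hv) (by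
    rwa [card_pair hxy, R.card_neighborFinset_eq_degree])
  have hvx : R.Adj v x := by
    rw [← R.mem_neighborFinset, hnb]; simp
  have hvy : R.Adj v y := by
    rw [← R.mem_neighborFinset, hnb]; simp
  have hH3 : #({x, y, v} : Finset V) = 3 := card_eq_three.2 ⟨x, y, v, hxy, hvx.ne', hvy.ne', rfl⟩
  -- Nine stars are needed: three here, one at each of the five other vertices, and one more at `u`.
  set c : V → ℕ := fun t => if t = x then 1 else if t = v then 2 else 0 with hc
  have hcx : c x = 1 := if_pos rfl
  have hcy : c y = 0 := by simp [hc, hxy.symm, hvy.ne']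
  have hcv : c v = 2 := by simp [hc, hvx.ne]
  have hsum : ∑ t ∈ {x, y, v}, c t = 3 := by
    simp [sum_insert, hxy, hvx.ne', hvy.ne', hcx, hcy, hcv]
  have hd := degree_compl_add (R := R)
  have hdx := hd x
  have hdy := hd y
  have hdv := hd v
  have hv3 := hle v hv
  have hb := bounds_of_pair (k := 2) (H := {x, y, v}) (c := c) (G := Rᶜ) (x := x) (y := y)
    (by omega) (fun s hs t ht hst => by
      simp only [mem_insert, mem_singleton] at hs ht
      rw [SimpleGraph.compl_adj] at hst
      rw [Sym2.eq_iff]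
      rcases hs with rfl | rfl | rfl <;> rcases ht with rfl | rfl | rfl <;>
        simp_all [R.adj_comm])
    (fun t ht => by
      simp only [mem_insert, mem_singleton] at ht
      rcases ht with rfl | rfl | rfl <;> omega)
    (fun _ => by omega)
  have hl : ∀ t ∉ ({x, y, v} : Finset V), 2 * R.degree t + #({x, y, v} : Finset V) ≤
      Fintype.card V + 1 := fun t ht => by
    have := hle t (mem_compl.2 fun h => ht (by
      simp only [mem_insert, mem_singleton] at h ⊢
      tauto))
    omega
  have huH : u ∈ ({x, y, v} : Finset V)ᶜ := by
    simp only [mem_compl, mem_insert, mem_singleton, not_or] at hu ⊢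
    exact ⟨hu.1, hu.2, fun h => by subst h; omega⟩
  have hcap : 1 ≤ ∑ t ∈ ({x, y, v} : Finset V)ᶜ, capacity R 2 {x, y, v} t := by
    refine le_trans ?_ (single_le_sum (fun _ _ => Nat.zero_le _) huH)
    rw [capacity, hH3, hn]
    omega
  zify at hcap
  refine exists_isCentral_of_capacity (H := {x, y, v}) (M := 9) (l := 1) ?_ hb.1 hb.2 hl zero_le_one
    ?_ ?_
  · rw [adjCount_compl_univ, ← Nat.cast_sum, hR, hn]
    norm_num
  · rw [hsum, hH3, hn]
    norm_num
  · rw [hsum, hH3, hn]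
    push_cast
    linarith

variable (h : Parameters k (Fintype.card V - 1) a M) (hR : ∑ v, R.degree v = 2 * (k * a))

omit [DecidableEq V] in
include h in
lemma Parameters.card_mul : (Fintype.card V - 1 : ℤ) * Fintype.card V = 2 * k * (M + a) := by
  linarith [h.total]

include h hR

lemma Parameters.exists_isCentral_zero (light : ∀ v, 2 * R.degree v ≤ Fintype.card V + 1) :
    ∃ c : V → ℕ, IsCentral Rᶜ k c := by
  have hk : 2 ≤ k := by exact_mod_cast h.two_le
  have hl : ∀ v ∉ (∅ : Finset V), 2 * R.degree v + #(∅ : Finset V) ≤ Fintype.card V + 1 :=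
    fun v _ => by simpa using light v
  have h1 := le_capacity_sum hl (k := k) (by omega)
  rw [sum_compl_degree hR, card_empty, sum_empty] at h1
  obtain ⟨l, hl0, h2, h3⟩ := exists_level_zero h
    (Q := (∑ v ∈ ∅ᶜ, capacity R k ∅ v : ℕ)) (by push_cast at h1 ⊢; linarith)
  refine exists_isCentral_of_capacity (H := ∅) (c := fun _ => 0) (adjCount_compl_eq hR h.card_mul)
    (fun X hX => ?_) (fun X hX => ?_) hl hl0 ?_ (le_trans ?_ h3)
  · simp [subset_empty.1 hX, adjCount]
  · simp [subset_empty.1 hX, adjCount]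
  · simp; linarith
  · simp

lemma Parameters.exists_isCentral_one {x : V} (hx : Fintype.card V + 2 ≤ 2 * R.degree x)
    (light : ∀ v, v ≠ x → 2 * R.degree v ≤ Fintype.card V) :
    ∃ c : V → ℕ, IsCentral Rᶜ k c := by
  have hk : 2 ≤ k := by exact_mod_cast h.two_le
  have hn : 2 * k + 3 ≤ Fintype.card V := by zify; linarith [h.le]
  have hl : ∀ v ∉ ({x} : Finset V), 2 * R.degree v + #{x} ≤ Fintype.card V + 1 :=
    fun v hv => by simpa using light v (by simpa using hv)
  have h1 := le_capacity_sum hl (k := k) (by omega)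
  have h2 := mul_sub_capacity_sum_le hl (k := k) (by omega) (by rw [card_singleton]; omega)
  have h3 := sum_degree_le hR {x}
  rw [sum_compl_degree hR, sum_singleton, card_singleton] at h1 h2
  rw [sum_singleton, card_singleton] at h3
  have h4 := degree_compl_add (R := R) x
  have h5 := Nat.div_add_mod (Rᶜ.degree x) k
  have h6 := Nat.mod_lt (Rᶜ.degree x) (show k > 0 by omega)
  set d := Rᶜ.degree x
  have hb := bounds_of_pair (k := k) (H := {x}) (c := fun _ => d / k) (G := Rᶜ) (x := x) (y := x)
    (by omega) (by simp) (by simpa [d] using Nat.mul_div_le _ _) (by simp)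
  zify at h4 h5 h6 hx
  push_cast at h1 h2 h3
  obtain ⟨l, hl0, h7, h8⟩ := exists_level_one h (c := ((d / k : ℕ) : ℤ)) (D := R.degree x)
    (ρ := ((d % k : ℕ) : ℤ)) (Q := (∑ v ∈ {x}ᶜ, capacity R k {x} v : ℕ)) (by push_cast; linarith)
    (Int.natCast_nonneg _) (by push_cast; linarith) (by linarith) (by linarith)
    (by push_cast; linarith) (by push_cast; linarith)
  refine exists_isCentral_of_capacity (H := {x}) (adjCount_compl_eq hR h.card_mul) hb.1 hb.2 hl
    hl0 ?_ (le_trans (le_of_eq ?_) h8)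
  · rw [sum_singleton, card_singleton]
    push_cast at h7 ⊢
    linarith
  · rw [sum_singleton, card_singleton]
    push_cast
    ring

/-- `ρ` is the part of the two degrees in `Rᶜ` not used by stars at `x` and `y`. It must be positive
if `xy` is an edge of `Rᶜ`, which both degrees count; the upper bounds on it are those required by
`exists_level_two`. -/
lemma Parameters.exists_isCentral_two {x y : V} (hxy : x ≠ y) {cx cy ρ : ℕ}
    (hx : Fintype.card V + 2 ≤ 2 * R.degree x) (hy : Fintype.card V + 1 ≤ 2 * R.degree y)
    (light : ∀ v, v ≠ x → v ≠ y → 2 * R.degree v + 1 ≤ Fintype.card V)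
    (hcx : k * cx ≤ Rᶜ.degree x) (hcy : k * cy ≤ Rᶜ.degree y)
    (hρ : k * (cx + cy) + ρ = Rᶜ.degree x + Rᶜ.degree y) (hρk : ρ + 2 ≤ 2 * k)
    (hρn : Fintype.card V = 4 * k → ρ + 3 ≤ 2 * k)
    (hadj : Rᶜ.Adj x y → 1 ≤ cx + cy ∧ 1 ≤ ρ) : ∃ c : V → ℕ, IsCentral Rᶜ k c := by
  have hk : 2 ≤ k := by exact_mod_cast h.two_le
  have hn : 2 * k + 3 ≤ Fintype.card V := by zify; linarith [h.le]
  have hcard : #({x, y} : Finset V) = 2 := card_pair hxy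
  have hl : ∀ v ∉ ({x, y} : Finset V), 2 * R.degree v + #({x, y} : Finset V) ≤
      Fintype.card V + 1 := fun v hv => by
    rw [hcard]
    have := light v (fun h => hv (by simp [h])) fun h => hv (by simp [h])
    omega
  have h1 := le_capacity_sum hl (k := k) (by omega)
  have h2 := mul_sub_capacity_sum_le hl (k := k) (by omega) (by omega)
  have h2' := le_capacity_sum_of_even hl (k := k) (by omega)
  have h3 := sum_degree_le hR {x, y}
  rw [sum_compl_degree hR, sum_pair hxy, hcard] at h1 h2 h2'
  rw [sum_pair hxy, hcard] at h3
  have h4 := degree_compl_add (R := R) x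
  have h5 := degree_compl_add (R := R) y
  set c : V → ℕ := fun v => if v = x then cx else cy with hc
  have hcx' : c x = cx := if_pos rfl
  have hcy' : c y = cy := if_neg hxy.symm
  have hcsum : ∑ v ∈ {x, y}, c v = cx + cy := by rw [sum_pair hxy, hcx', hcy']
  have hb := bounds_of_pair (k := k) (H := {x, y}) (c := c) (G := Rᶜ) (x := x) (y := y)
    (by omega) (fun u hu v hv huv => by
      simp only [mem_insert, mem_singleton] at hu hv
      have := huv.ne
      rw [Sym2.eq_iff]
      rcases hu with rfl | rfl <;> rcases hv with rfl | rfl <;> simp_all)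
    (fun v hv => by
      simp only [mem_insert, mem_singleton] at hv
      rcases hv with rfl | rfl
      · rwa [hcx']
      · rwa [hcy'])
    (fun hG => by
      obtain ⟨h6, h7⟩ := hadj hG
      rw [hcx', hcy']
      omega)
  have hx2 : (Fintype.card V : ℤ) + 2 ≤ R.degree x + R.degree y := by omega
  zify at h4 h5 hρ hρk
  push_cast at h1 h2 h3
  obtain ⟨l, hl0, h7, h8⟩ := exists_level_two h (c := cx + cy) (D := R.degree x + R.degree y)
    (ρ := ρ) (Q := (∑ v ∈ {x, y}ᶜ, capacity R k {x, y} v : ℕ)) (by linarith)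
    (Int.natCast_nonneg _) (by linarith)
    (fun hN => by
      have := hρn (by zify; linarith)
      zify at this
      linarith)
    (by linarith) (by linarith)
    (by push_cast; linarith)
    (fun hN => by
      have := h2' ⟨2 * k + 2, by
        have : Fintype.card V = 4 * k + 1 := by zify; linarith
        omega⟩
      push_cast at this ⊢
      linarith) (by push_cast; linarith)
  refine exists_isCentral_of_capacity (H := {x, y}) (adjCount_compl_eq hR h.card_mul) hb.1 hb.2 hl
    hl0 ?_ (le_trans (le_of_eq ?_) h8)
  · rw [hcsum, hcard]
    push_cast at h7 ⊢
    linarith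
  · rw [hcsum, hcard]
    push_cast
    ring

lemma Parameters.exists_isCentral_three {x y z : V} (hxy : x ≠ y) (hxz : x ≠ z) (hyz : y ≠ z)
    (hx : Fintype.card V + 2 ≤ 2 * R.degree x) (hy : Fintype.card V + 1 ≤ 2 * R.degree y)
    (hz : Fintype.card V ≤ 2 * R.degree z)
    (light : ∀ v, v ≠ x → v ≠ y → v ≠ z → 2 * R.degree v + 2 ≤ Fintype.card V) :
    ∃ c : V → ℕ, IsCentral Rᶜ k c := by
  have hk : 2 ≤ k := by exact_mod_cast h.two_le
  have hn : 2 * k + 3 ≤ Fintype.card V := by zify; linarith [h.le]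
  have hcard : #({x, y, z} : Finset V) = 3 := card_eq_three.2 ⟨x, y, z, hxy, hxz, hyz, rfl⟩
  have hsum : ∀ f : V → ℕ, ∑ v ∈ {x, y, z}, f v = f x + (f y + f z) := fun f => by
    rw [sum_insert (by simp [hxy, hxz]), sum_pair hyz]
  have hsum' : ∀ f : V → ℕ, ∑ v ∈ {x, y, z}, (f v : ℤ) = f x + (f y + f z) := fun f => by
    exact_mod_cast congrArg (Nat.cast : ℕ → ℤ) (hsum f)
  have hl : ∀ v ∉ ({x, y, z} : Finset V), 2 * R.degree v + #({x, y, z} : Finset V) ≤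
      Fintype.card V + 1 := fun v hv => by
    rw [hcard]
    have := light v (fun h => hv (by simp [h])) (fun h => hv (by simp [h]))
      fun h => hv (by simp [h])
    omega
  have h1 := le_capacity_sum hl (k := k) (by omega)
  have h2 := mul_sub_capacity_sum_le hl (k := k) (by omega) (by omega)
  have h3 := sum_degree_le hR {x, y, z}
  rw [sum_compl_degree hR, hsum', hcard] at h1 h2
  rw [hsum', hcard] at h3
  have hd := degree_compl_add (R := R)
  have hka := h.mul_le
  -- Subtracting 1 keeps in reserve the edge required by `bounds_of_card_le_three`.
  set c : V → ℕ := fun v => (Rᶜ.degree v - 1) / k with hc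
  have hck : ∀ v, k * c v ≤ Rᶜ.degree v - 1 := fun v => Nat.mul_div_le _ _
  have hck' : ∀ v, Rᶜ.degree v ≤ k * c v + k := fun v => by
    have h4 := Nat.div_add_mod (Rᶜ.degree v - 1) k
    have h5 := Nat.mod_lt (Rᶜ.degree v - 1) (show k > 0 by omega)
    change k * c v + _ = _ at h4
    omega
  have hpos : ∀ v, k < Rᶜ.degree v → 1 ≤ c v := fun v hv =>
    Nat.div_pos (by omega) (by omega)
  have hdx := hd x
  have hdy := hd y
  have hdz := hd z
  push_cast at h1 h2 h3
  have hD : (R.degree x : ℤ) + (R.degree y + R.degree z) ≤ 2 * Fintype.card V + 1 - k - 2 := by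
    linarith
  have hD' : R.degree x + (R.degree y + R.degree z) + k + 1 ≤ 2 * Fintype.card V := by
    zify; linarith
  -- By `hD'`, at most one of the three has degree at most `k` in `Rᶜ`.
  obtain ⟨w, hw⟩ : ∃ w, ∀ v ∈ ({x, y, z} : Finset V), v ≠ w → 1 ≤ c v := by
    by_cases hx' : k < Rᶜ.degree x
    · by_cases hy' : k < Rᶜ.degree y
      · refine ⟨z, fun v hv hvw => ?_⟩
        simp only [mem_insert, mem_singleton] at hv
        rcases hv with rfl | rfl | rfl
        exacts [hpos _ hx', hpos _ hy', absurd rfl hvw]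
      · refine ⟨y, fun v hv hvw => ?_⟩
        simp only [mem_insert, mem_singleton] at hv
        rcases hv with rfl | rfl | rfl
        exacts [hpos _ hx', absurd rfl hvw, hpos _ (by omega)]
    · refine ⟨x, fun v hv hvw => ?_⟩
      simp only [mem_insert, mem_singleton] at hv
      rcases hv with rfl | rfl | rfl
      exacts [absurd rfl hvw, hpos _ (by omega), hpos _ (by omega)]
  have hb := bounds_of_card_le_three hk hcard.le (fun v _ => hck v) w hw
  have hx3 : 3 * (Fintype.card V : ℤ) + 4 ≤
    2 * (R.degree x + (R.degree y + R.degree z)) := by omega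
  have hcx := hck x
  have hcy := hck y
  have hcz := hck z
  have hcx' := hck' x
  have hcy' := hck' y
  have hcz' := hck' z
  have hle : k * c x + (k * c y + k * c z) ≤ Rᶜ.degree x + (Rᶜ.degree y + Rᶜ.degree z) := by omega
  have hle' : Rᶜ.degree x + (Rᶜ.degree y + Rᶜ.degree z) ≤
      k * c x + (k * c y + k * c z) + 3 * k := by omega
  zify at hdx hdy hdz hle hle'
  obtain ⟨l, hl0, h7, h8⟩ := exists_level_three h (c := c x + (c y + c z))
    (D := R.degree x + (R.degree y + R.degree z))
    (ρ := Rᶜ.degree x + (Rᶜ.degree y + Rᶜ.degree z) - (k * c x + (k * c y + k * c z)))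
    (Q := (∑ v ∈ {x, y, z}ᶜ, capacity R k {x, y, z} v : ℕ)) (by linarith)
    (by linarith) (by linarith) (by linarith) (by linarith)
    (by push_cast; linarith) (by push_cast; linarith)
  refine exists_isCentral_of_capacity (H := {x, y, z}) (adjCount_compl_eq hR h.card_mul) hb.1 hb.2
    hl hl0 ?_ (le_trans (le_of_eq ?_) h8)
  · rw [hsum, hcard]
    push_cast at h7 ⊢
    linarith
  · rw [hsum, hcard]
    push_cast
    ring

/-- The choice of `c` when exactly two vertices are exceptional. -/
lemma Parameters.exists_isCentral_pair {x y : V} (hxy : x ≠ y)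
    (hx : Fintype.card V + 2 ≤ 2 * R.degree x) (hy : Fintype.card V + 1 ≤ 2 * R.degree y)
    (light : ∀ v, v ≠ x → v ≠ y → 2 * R.degree v + 1 ≤ Fintype.card V)
    (hpair : Rᶜ.Adj x y → ¬(Fintype.card V ≤ R.degree x + k ∧ Fintype.card V ≤ R.degree y + k)) :
    ∃ c : V → ℕ, IsCentral Rᶜ k c := by
  have hk : 2 ≤ k := by exact_mod_cast h.two_le
  have hdx := degree_compl_add (R := R) x
  have hdy := degree_compl_add (R := R) y
  have hsum := sum_degree_le hR {x, y}
  rw [sum_pair hxy, card_pair hxy] at hsum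
  have hsum' : R.degree x + R.degree y ≤ k * a + 1 := by
    zify; push_cast at hsum; linarith
  have ha : Fintype.card V = 4 * k → a ≤ 5 := fun hn => by
    have h4 := h.le_five
    rw [hn] at h4
    push_cast at h4
    have := h4 (by linarith)
    exact_mod_cast this
  have hx1 := Nat.div_add_mod (Rᶜ.degree x) k
  have hx2 := Nat.mod_lt (Rᶜ.degree x) (show k > 0 by omega)
  have hy1 := Nat.div_add_mod (Rᶜ.degree y) k
  have hy2 := Nat.mod_lt (Rᶜ.degree y) (show k > 0 by omega)
  generalize Rᶜ.degree x / k = p at hx1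
  generalize Rᶜ.degree x % k = s at hx1 hx2
  generalize Rᶜ.degree y / k = p' at hy1
  generalize Rᶜ.degree y % k = s' at hy1 hy2
  have hone : Rᶜ.Adj x y → 1 ≤ p + p' := fun hG => by
    by_contra h0
    obtain ⟨h1, h2⟩ : p = 0 ∧ p' = 0 := by omega
    rw [h1] at hx1
    rw [h2] at hy1
    exact hpair hG (by omega)
  -- If `k` divides both degrees, rounding down leaves no spare edge for `xy`, so `x` gives up one
  -- star and `ρ = k`. This violates a bound on `ρ` only for `k = 2` and eight vertices.
  by_cases hcase : Rᶜ.Adj x y ∧ s = 0 ∧ s' = 0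
  · obtain ⟨hG, hs, hs'⟩ := hcase
    rw [hs, add_zero] at hx1
    rw [hs', add_zero] at hy1
    have hp : 1 ≤ p := by
      rw [Nat.one_le_iff_ne_zero]
      rintro h0
      rw [h0, mul_zero] at hx1
      exact ((Rᶜ.degree_pos_iff_exists_adj x).2 ⟨y, hG⟩).ne hx1
    have hp' : 1 ≤ p' := by
      rw [Nat.one_le_iff_ne_zero]
      rintro h0
      rw [h0, mul_zero] at hy1
      exact ((Rᶜ.degree_pos_iff_exists_adj y).2 ⟨x, hG.symm⟩).ne hy1
    obtain ⟨p, rfl⟩ : ∃ t, p = t + 1 := ⟨p - 1, by omega⟩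
    by_cases hexc : Fintype.card V = 4 * k ∧ k = 2
    · obtain ⟨hn, rfl⟩ := hexc
      have := ha hn
      have ha5 : a = 5 := by omega
      subst ha5
      exact exists_isCentral_eight (by omega) (by omega) hG (by omega) (by omega)
    · refine h.exists_isCentral_two hR hxy (cx := p) (cy := p') (ρ := k) hx hy light ?_ hy1.le ?_
        (by omega) (fun hn => by omega) fun _ => by omega
      · rw [← hx1]
        exact Nat.mul_le_mul_left _ (Nat.le_succ _)
      · rw [← hx1, ← hy1]
        ring
  · refine h.exists_isCentral_two hR hxy (cx := p) (cy := p') (ρ := s + s') hx hy light (by omega)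
      (by omega) (by rw [mul_add]; omega) (by omega) (fun hn => ?_) fun hG => ⟨hone hG, by
        by_contra h0
        exact hcase ⟨hG, by omega⟩⟩
    -- Otherwise both remainders are `k - 1`. As both degrees in `Rᶜ` are below `2 * k - 1`, they
    -- equal `k - 1`, so the degrees in `R` add up to more than `a ≤ 5` allows.
    by_contra h0
    have h1 : Rᶜ.degree x = s := by
      by_cases hp : p = 0
      · rw [hp] at hx1; omega
      · have := Nat.le_mul_of_pos_right k (Nat.pos_of_ne_zero hp)
        omega
    have h2 : Rᶜ.degree y = s' := by
      by_cases hp : p' = 0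
      · rw [hp] at hy1; omega
      · have := Nat.le_mul_of_pos_right k (Nat.pos_of_ne_zero hp)
        omega
    have := Nat.mul_le_mul_left k (ha hn)
    omega

/-- The exceptional set grows one vertex at a time until every other vertex satisfies `2 * R.degree
v + #H ≤ n + 1`, a condition that tightens with `#H`. -/
lemma Parameters.exists_isCentral
    (hpair : ∀ x y, Rᶜ.Adj x y →
      ¬(Fintype.card V ≤ R.degree x + k ∧ Fintype.card V ≤ R.degree y + k)) :
    ∃ c : V → ℕ, IsCentral Rᶜ k c := by
  by_cases h0 : ∀ v, 2 * R.degree v ≤ Fintype.card V + 1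
  · exact h.exists_isCentral_zero hR h0
  push Not at h0
  obtain ⟨x, hx⟩ := h0
  by_cases h1 : ∀ v, v ≠ x → 2 * R.degree v ≤ Fintype.card V
  · exact h.exists_isCentral_one hR (by omega) h1
  push Not at h1
  obtain ⟨y, hyx, hy⟩ := h1
  by_cases h2 : ∀ v, v ≠ x → v ≠ y → 2 * R.degree v + 1 ≤ Fintype.card V
  · exact h.exists_isCentral_pair hR hyx.symm (by omega) (by omega) h2 (hpair x y)
  push Not at h2
  obtain ⟨z, hzx, hzy, hz⟩ := h2
  refine h.exists_isCentral_three hR hyx.symm hzx.symm hzy.symm (by omega) (by omega) (by omega)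
    fun t htx hty htz => ?_
  -- Four exceptional vertices would have doubled degree sum at least `4 * n + 2`, against the upper
  -- bound `4 * n + 4 - 2 * k`.
  by_contra h3
  have h4 := sum_degree_le hR {t, x, y, z}
  have hcard : #({t, x, y, z} : Finset V) = 4 := by
    rw [card_insert_of_notMem (by simp [htx, hty, htz]),
      card_eq_three.2 ⟨x, y, z, hyx.symm, hzx.symm, hzy.symm, rfl⟩]
  rw [hcard, sum_insert (by simp [htx, hty, htz]), sum_insert (by simp [hyx.symm, hzx.symm]),
    sum_pair hzy.symm] at h4
  have h5 := h.mul_le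
  have h6 := h.two_le
  zify at hx hy hz h3
  push_cast at h4
  linarith

omit h in
theorem exists_isCentral_of_le_starThreshold (hk : 2 ≤ k) (hn : 2 * k ≤ Fintype.card V)
    (hadm : k ∣ (Fintype.card V).choose 2) (ha : (a : ℤ) ≤ starThreshold (Fintype.card V) k)
    (hpair : ∀ x y, Rᶜ.Adj x y →
      ¬(Fintype.card V ≤ R.degree x + k ∧ Fintype.card V ≤ R.degree y + k)) :
    ∃ c : V → ℕ, IsCentral Rᶜ k c := by
  obtain ⟨q, r, hr, hqr⟩ : ∃ q r, r < k ∧ Fintype.card V = k * q + r + 1 :=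
    ⟨(Fintype.card V - 1) / k, (Fintype.card V - 1) % k, Nat.mod_lt _ (by omega), by
      rw [Nat.div_add_mod]; omega⟩
  have ha1 : (a : ℤ) ≤ 2 * q - 1 ∧ (r = 0 → (a : ℤ) ≤ 2 * q - 2) := by
    rw [hqr] at ha
    rcases Nat.eq_zero_or_pos r with rfl | hr0
    · rw [add_zero, starThreshold_of_dvd (by omega)] at ha
      exact ⟨by linarith, fun _ => ha⟩
    · rw [starThreshold_of_pos hr0 hr] at ha
      exact ⟨ha, fun h => absurd h hr0.ne'⟩
  obtain ⟨m, hm⟩ := hadm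
  have hm2 : (Fintype.card V - 1 : ℤ) * Fintype.card V = 2 * (k * m) := by
    have h1 := Nat.choose_two_right (Fintype.card V)
    have h2 := Nat.even_mul_pred_self (Fintype.card V)
    have h3 : Fintype.card V * (Fintype.card V - 1) = 2 * (k * m) := by
      rw [← hm, h1, Nat.mul_div_cancel' h2.two_dvd]
    zify [show 1 ≤ Fintype.card V by omega] at h3
    linarith
  have ham : a ≤ m := by
    have h1 := adjCount_nonneg Rᶜ univ univ
    have h2 := adjCount_compl_univ (R := R)
    zify at hR
    rw [hR] at h2
    have h3 : (k : ℤ) * a ≤ k * m := by linarith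
    exact Nat.le_of_mul_le_mul_left (by exact_mod_cast h3) (show 0 < k by omega)
  obtain ⟨M, rfl⟩ := Nat.exists_eq_add_of_le' ham
  push_cast at hm2
  -- Order `2 * k + 2` is not admissible, since `k` would divide 1.
  rcases lt_or_ge (Fintype.card V) (2 * k + 3) with hlt | hge
  · refine exists_isCentral_of_card_le hk hR (by linarith) ?_
    obtain hn | hn | hn : Fintype.card V = 2 * k ∨ Fintype.card V = 2 * k + 1 ∨
        Fintype.card V = 2 * k + 2 := by omega
    · have hq : q < 2 := by
        by_contra h
        have := Nat.mul_le_mul_left k (not_lt.1 h)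
        omega
      exact Or.inl ⟨hn, by omega⟩
    · have hq : q < 3 := by
        by_contra h
        have := Nat.mul_le_mul_left k (not_lt.1 h)
        omega
      have hq' : q = 2 → r = 0 := by rintro rfl; omega
      exact Or.inr ⟨hn, by omega⟩
    · rw [hn] at hm2
      push_cast at hm2
      have h1 : (k : ℤ) ∣ 1 := ⟨M + a - 2 * k - 3, by linarith⟩
      have := Int.le_of_dvd one_pos h1
      omega
  · exact (parameters_of_threshold (q := q) (r := r) (by exact_mod_cast hk) (by omega) (by positivity)
      (by linarith) (by rw [hqr]; push_cast; ring) (by positivity) (by exact_mod_cast hr) ha1.1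
      fun h => ha1.2 (by exact_mod_cast h)).exists_isCentral hR hpair

end Completion

end StarDesign

theorem theorem1 (k : ℕ) (hk : 2 ≤ k) :
    (∀ n : ℕ, Admissible k n → 2 * k ≤ n →
      ∀ (V : Type*) [Fintype V], Fintype.card V = n →
        ∀ A : Finset (⊤ : SimpleGraph V).Subgraph, IsPartialStarDesign k A →
          (A.card : ℤ) ≤ starThreshold n k → HasCompletion k A) ∧
    (∀ n : ℕ, Admissible k n → 1 < n →
      ∃ A : Finset (⊤ : SimpleGraph (Fin n)).Subgraph, IsPartialStarDesign k A ∧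
        (A.card : ℤ) = starThreshold n k + 1 ∧ ¬ HasCompletion k A) := by
  classical
  refine ⟨?_, fun n _ hn => StarDesign.exists_not_hasCompletion hk hn⟩
  rintro n ⟨-, hadm⟩ hn V _ rfl A ⟨G, hG⟩ hcard
  have : Nonempty V := Fintype.card_pos_iff.1 (by omega)
  obtain ⟨c, hc⟩ := StarDesign.exists_isCentral_of_le_starThreshold
    (StarDesign.sum_degree_unionGraph hG.isStar hG.disjoint) hk hn
    ((Nat.modEq_zero_iff_dvd).1 hadm) hcard fun x y hxy hxy' =>
      (StarDesign.starThreshold_lt_card hk hG.isStar hG.disjoint hxy.ne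
        ((SimpleGraph.compl_adj _ x y).1 hxy).2 hxy'.1 hxy'.2).not_ge hcard
  exact hc.hasCompletion hG.isStar hG.disjoint
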